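/- A Steiner triple system of order $v$, $\mathrm{STS}(v)$, is a pair $(V,\mathcal B)$ where $|V|=v$ and $\mathcal B$ is a set of $3$-subsets of $V$ (lines) such that every $2$-subset of $V$ is contained in exactly one line. A configuration in $(V,\mathcal B)$ is a pair $(V',\mathcal B')$ with $\mathcal B'\subseteq\mathcal B$ and $V'=\bigcup_{B\in\mathcal B'}B$; two configurations are isomorphic if there is a bijection between their point sets that maps lines onto lines. The number of occurrences of a configuration $C$ in an $\mathrm{STS}(v)$ is the number of configurations in it that are isomorphic to $C$. The configuration $C$ is constant if, for every $v$, this number is the same for all $\mathrm{STS}(v)$, and variable otherwise. Theorem. Let $C$ be a fixed variable configuration with exactly $5$ lines. Then the number of occurrences of $C$ in an $\mathrm{STS}(v)$ can be computed in time $O(v^3)$. That is, there is one program for a random-access machine with words of $O(\log v)$ bits and unit cost per operation which, for every $v$ and every $\mathrm{STS}(v)$ with point set $\{0,\dots,v-1\}$, given as $v$ followed by a list of its lines (in any order), outputs the number of occurrences of $C$ after at most $T(v)$ steps, where $T(v)=O(v^3)$ as $v\to\infty$; the program, the word-length constant and $T$ depend only on $C$. -/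

import Mathlib

open Filter Asymptotics

/-! ## Steiner triple systems and configurations -/

/-- A Steiner triple system on the point set `V`: a set of 3-subsets of `V` (the lines) such that
every 2-subset of `V` is contained in exactly one line. Its order is the cardinality of `V`. -/
structure SteinerTripleSystem (V : Type*) where
  lines : Finset (Finset V)
  card_line : ∀ B ∈ lines, B.card = 3
  existsUnique_line : ∀ x y : V, x ≠ y → ∃! B : Finset V, B ∈ lines ∧ x ∈ B ∧ y ∈ B

/-- A configuration in `S` is given by its line set `C`, a subset of the lines of `S`;
its point set is the union of its lines, see `configPoints`. -/
def IsConfiguration {V : Type*} (S : SteinerTripleSystem V) (C : Finset (Finset V)) : Prop :=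
  C ⊆ S.lines

/-- The point set of the configuration with line set `C`: the union of its lines. -/
def configPoints {V : Type*} (C : Finset (Finset V)) : Set V :=
  {x | ∃ B ∈ C, x ∈ B}

/-- Two configurations are isomorphic if there is a bijection between their point sets that maps
the lines of the first one onto the lines of the second one. -/
def ConfigIsomorphic {V W : Type*} (C : Finset (Finset V)) (D : Finset (Finset W)) : Prop :=
  ∃ e : configPoints C ≃ configPoints D, ∀ B : Finset (configPoints C),
    B.map (Function.Embedding.subtype _) ∈ C ↔
      (B.map e.toEmbedding).map (Function.Embedding.subtype _) ∈ D

/-- The number of occurrences of the configuration `C` in `S`: the number of configurations in `S`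
that are isomorphic to `C`. -/
noncomputable def occurrences {V W : Type*} (C : Finset (Finset V))
    (S : SteinerTripleSystem W) : ℕ :=
  Set.ncard {D : Finset (Finset W) | IsConfiguration S D ∧ ConfigIsomorphic C D}

/-- A configuration is constant if its number of occurrences in a Steiner triple system
depends only on the order of the system. -/
def IsConstantConfig {V : Type*} (C : Finset (Finset V)) : Prop :=
  ∀ (v : ℕ) (S S' : SteinerTripleSystem (Fin v)), occurrences C S = occurrences C S'

/-- A configuration is variable if it is not constant. -/
def IsVariableConfig {V : Type*} (C : Finset (Finset V)) : Prop :=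
  ¬ IsConstantConfig C

/-! ## Random-access machines with bounded words and unit cost -/

namespace RAM

/-- The state of the machine: registers, which programs address by fixed numbers, and a memory,
which programs address through the contents of registers. -/
structure State where
  reg : ℕ → ℕ
  mem : ℕ → ℕ

def State.setReg (s : State) (d x : ℕ) : State :=
  { s with reg := Function.update s.reg d x }

def State.setMem (s : State) (a x : ℕ) : State :=
  { s with mem := Function.update s.mem a x }

/-- Arithmetic operations on natural numbers: addition, truncated subtraction, multiplication and
division with rounding down (with quotient 0 if the divisor is 0). -/
inductive Op
  | add
  | sub
  | mul
  | div

def Op.eval : Op → ℕ → ℕ → ℕ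
  | .add, x, y => x + y
  | .sub, x, y => x - y
  | .mul, x, y => x * y
  | .div, x, y => x / y

/-- Comparisons of the contents of two registers. -/
inductive Test
  | eq (a b : ℕ)
  | lt (a b : ℕ)

def Test.Holds : Test → State → Prop
  | .eq a b, s => s.reg a = s.reg b
  | .lt a b, s => s.reg a < s.reg b

/-- Programs of the machine; the numbers `d`, `a`, `b` are names of registers. -/
inductive Prog
  | skip
  /-- write the constant `n` into register `d` -/
  | const (d n : ℕ)
  /-- copy register `a` into register `d` -/
  | copy (d a : ℕ)
  /-- apply an operation to registers `a` and `b` and write the result into register `d` -/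
  | arith (op : Op) (d a b : ℕ)
  /-- write into register `d` the content of the memory cell whose address is in register `a` -/
  | load (d a : ℕ)
  /-- write register `b` into the memory cell whose address is in register `a` -/
  | store (a b : ℕ)
  | seq (p q : Prog)
  | ite (c : Test) (p q : Prog)
  | while (c : Test) (p : Prog)

/-- `Exec W p s t s'`: on a machine whose words hold the natural numbers below `W`, the program `p`
started in the state `s` halts in the state `s'` after exactly `t` steps. Each basic instruction
and each evaluation of a test is one step. There is no execution in which a register
would receive a number that does not fit into a word. -/
inductive Exec (W : ℕ) : Prog → State → ℕ → State → Prop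
  | skip (s : State) : Exec W .skip s 1 s
  | const (s : State) (d n : ℕ) (h : n < W) : Exec W (.const d n) s 1 (s.setReg d n)
  | copy (s : State) (d a : ℕ) (h : s.reg a < W) : Exec W (.copy d a) s 1 (s.setReg d (s.reg a))
  | arith (s : State) (op : Op) (d a b : ℕ) (h : op.eval (s.reg a) (s.reg b) < W) :
      Exec W (.arith op d a b) s 1 (s.setReg d (op.eval (s.reg a) (s.reg b)))
  | load (s : State) (d a : ℕ) (h : s.mem (s.reg a) < W) :
      Exec W (.load d a) s 1 (s.setReg d (s.mem (s.reg a)))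
  | store (s : State) (a b : ℕ) : Exec W (.store a b) s 1 (s.setMem (s.reg a) (s.reg b))
  | seq {p q : Prog} {s s' s'' : State} {t t' : ℕ} (hp : Exec W p s t s')
      (hq : Exec W q s' t' s'') : Exec W (.seq p q) s (t + t') s''
  | ite_true {c : Test} {p q : Prog} {s s' : State} {t : ℕ} (hc : c.Holds s)
      (hp : Exec W p s t s') : Exec W (.ite c p q) s (t + 1) s'
  | ite_false {c : Test} {p q : Prog} {s s' : State} {t : ℕ} (hc : ¬ c.Holds s)
      (hq : Exec W q s t s') : Exec W (.ite c p q) s (t + 1) s'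
  | while_true {c : Test} {p : Prog} {s s' s'' : State} {t t' : ℕ} (hc : c.Holds s)
      (hp : Exec W p s t s') (hw : Exec W (.while c p) s' t' s'') :
      Exec W (.while c p) s (t + t' + 1) s''
  | while_false {c : Test} {p : Prog} {s : State} (hc : ¬ c.Holds s) :
      Exec W (.while c p) s 1 s

/-- The initial state on a given input: the input words are in the memory cells `0, 1, 2, …`;
all other memory cells and all registers contain `0`. -/
def initial (input : List ℕ) : State where
  reg := fun _ => 0
  mem := fun a => input.getD a 0

end RAM

/-! ## Algorithms whose input is a Steiner triple system -/

/-- `L` lists the lines of `S`, each line exactly once, in any order and with the three points of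
each line in any order. -/
def IsLineListing {v : ℕ} (S : SteinerTripleSystem (Fin v))
    (L : List (Fin v × Fin v × Fin v)) : Prop :=
  (L.map fun l => ({l.1, l.2.1, l.2.2} : Finset (Fin v))).Nodup ∧
    ∀ B : Finset (Fin v),
      B ∈ S.lines ↔ B ∈ L.map fun l => ({l.1, l.2.1, l.2.2} : Finset (Fin v))

/-- The input words for a Steiner triple system on the points `0, …, v - 1`: the order `v`,
followed by the points of the listed lines, three words for each line. -/
def encodeInput (v : ℕ) (L : List (Fin v × Fin v × Fin v)) : List ℕ :=
  v :: L.flatMap fun l => [l.1.val, l.2.1.val, l.2.2.val]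

/-- The quantity `f` can be computed from a Steiner triple system of order `v` in time `O(g v)`:
there is one program that, for every order `v` and every Steiner triple system of order `v`,
halts with the value of `f` in register `0` after at most `T v` steps, where `T = O(g)`.
The words of the machine have `O(log v)` bits: they hold the numbers below `(v + 2) ^ k`. -/
def ComputableInTime (f : (v : ℕ) → SteinerTripleSystem (Fin v) → ℕ) (g : ℕ → ℝ) : Prop :=
  ∃ (p : RAM.Prog) (k : ℕ) (T : ℕ → ℕ),
    (fun v => (T v : ℝ)) =O[atTop] g ∧
    ∀ (v : ℕ) (S : SteinerTripleSystem (Fin v)) (L : List (Fin v × Fin v × Fin v)),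
      IsLineListing S L →
        ∃ (t : ℕ) (s : RAM.State),
          RAM.Exec ((v + 2) ^ k) p (RAM.initial (encodeInput v L)) t s ∧
            t ≤ T v ∧ s.reg 0 = f v S

/-! ## The Steiner quasigroup -/

/-! Let x * y be the third point of the line through x and y, with x * x = x. Embeddings of C into a
Steiner triple system are the injective solutions of at most five equations x * y = z in this
quasigroup, and each occurrence of C is the image of exactly |Aut C| embeddings (`card_embeddings`).
Injectivity is removed one inequality at a time: the solutions with x ≠ z are all solutions minus
those with x = z, and the latter solve a system with two variables merged and the same number of
equations (`cubicTime_card_solutions_ne`).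

It remains to count all solutions of at most five equations (`cubicTime_solutionCount`). A variable
in no equation contributes a factor v. A variable that occurs once is determined by the others and
leaves together with its equation. An equation that repeats a variable, or shares two variables with
another equation, only identifies two variables. If none of this applies and equations remain, they
form at most five lines, any two meeting in at most one point, with at least two lines through every
point. Such a configuration contains a triangle whose vertices generate all points
(`exists_generators`). Hence the solutions correspond to some of the v^3 triples of values at the
vertices, and each triple is tested with a bounded number of products (`CubicTime.card_equations`).

Products are looked up in a table, which is filled from the list of lines in O(v^3) steps
(`CubicTime.computableInTime`). -/

theorem Finset.ne_of_card_triple_eq_three {α : Type*} [DecidableEq α] {a b c : α}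
    (h : ({a, b, c} : Finset α).card = 3) : a ≠ b ∧ a ≠ c ∧ b ≠ c := by
  refine ⟨?_, ?_, ?_⟩ <;> rintro rfl <;>
    simp only [Finset.mem_singleton, Finset.mem_insert, true_or, or_true, Finset.insert_eq_of_mem]
      at h
  · exact absurd (h ▸ Finset.card_le_two) (by omega)
  · exact absurd (h ▸ Finset.card_le_two) (by omega)
  · exact absurd (h ▸ Finset.card_le_two) (by omega)

namespace SteinerTripleSystem

variable {v : ℕ} (S : SteinerTripleSystem (Fin v))

/-- The relation of being three points of a line, or three times the same point. -/
def Rel (x y z : Fin v) : Prop :=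
  (x = y ∧ y = z) ∨ (x ≠ y ∧ y ≠ z ∧ x ≠ z ∧ ({x, y, z} : Finset (Fin v)) ∈ S.lines)

theorem Rel.swap {S : SteinerTripleSystem (Fin v)} {x y z : Fin v} (h : S.Rel x y z) :
    S.Rel y x z := by
  rcases h with ⟨rfl, rfl⟩ | ⟨h1, h2, h3, h4⟩
  · exact Or.inl ⟨rfl, rfl⟩
  · exact Or.inr ⟨h1.symm, h3, h2, by rwa [Finset.insert_comm]⟩

theorem Rel.swap_right {S : SteinerTripleSystem (Fin v)} {x y z : Fin v} (h : S.Rel x y z) :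
    S.Rel x z y := by
  rcases h with ⟨rfl, rfl⟩ | ⟨h1, h2, h3, h4⟩
  · exact Or.inl ⟨rfl, rfl⟩
  · exact Or.inr ⟨h3, h2.symm, h1, by rwa [Finset.pair_comm z y]⟩

theorem exists_rel (x y : Fin v) : ∃ z, S.Rel x y z := by
  by_cases hxy : x = y
  · exact ⟨y, Or.inl ⟨hxy, rfl⟩⟩
  obtain ⟨B, ⟨hB, hx, hy⟩, -⟩ := S.existsUnique_line x y hxy
  have hc : ((B.erase x).erase y).card = 1 := by
    rw [Finset.card_erase_of_mem (by simp [hy, Ne.symm hxy]), Finset.card_erase_of_mem hx,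
      S.card_line B hB]
  obtain ⟨z, hz⟩ := Finset.card_eq_one.1 hc
  have hz' : z ∈ (B.erase x).erase y := by simp [hz]
  simp only [Finset.mem_erase, ne_eq] at hz'
  refine ⟨z, Or.inr ⟨hxy, Ne.symm hz'.1, Ne.symm hz'.2.1, ?_⟩⟩
  rw [← hz, Finset.insert_erase (by simp [hy, Ne.symm hxy]), Finset.insert_erase hx]
  exact hB

theorem Rel.unique {S : SteinerTripleSystem (Fin v)} {x y z w : Fin v} (h : S.Rel x y z)
    (h' : S.Rel x y w) : z = w := by
  rcases h with ⟨rfl, rfl⟩ | ⟨h1, h2, h3, h4⟩ <;> rcases h' with ⟨h1', h2'⟩ | ⟨h1', h2', h3', h4'⟩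
  · exact h2'
  · exact absurd rfl h1'
  · exact absurd h1' h1
  · have := (S.existsUnique_line x y h1).unique ⟨h4, by simp, by simp⟩ ⟨h4', by simp, by simp⟩
    have hz : z ∈ ({x, y, w} : Finset (Fin v)) := by rw [← this]; simp
    simp only [Finset.mem_insert, Finset.mem_singleton] at hz
    rcases hz with rfl | rfl | rfl
    · exact absurd rfl h3
    · exact absurd rfl h2
    · rfl

/-- The operation of the Steiner quasigroup: the third point of the line through two points. -/
noncomputable def op (x y : Fin v) : Fin v := (S.exists_rel x y).choose

theorem rel_op (x y : Fin v) : S.Rel x y (S.op x y) := (S.exists_rel x y).choose_spec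

theorem op_eq_iff {x y z : Fin v} : S.op x y = z ↔ S.Rel x y z :=
  ⟨fun h => h ▸ S.rel_op x y, fun h => (S.rel_op x y).unique h⟩

theorem op_self (x : Fin v) : S.op x x = x := S.op_eq_iff.2 (Or.inl ⟨rfl, rfl⟩)

theorem op_swap {x y z : Fin v} (h : S.op x y = z) : S.op y x = z :=
  S.op_eq_iff.2 (S.op_eq_iff.1 h).swap

theorem op_swap_right {x y z : Fin v} (h : S.op x y = z) : S.op x z = y :=
  S.op_eq_iff.2 (S.op_eq_iff.1 h).swap_right

end SteinerTripleSystem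

/-! ## Reasoning about executions -/

namespace RAM

theorem State.reg_setReg (s : State) (d x r : ℕ) :
    (s.setReg d x).reg r = if r = d then x else s.reg r := by
  simp [State.setReg, Function.update_apply]

@[simp] theorem State.mem_setReg (s : State) (d x : ℕ) : (s.setReg d x).mem = s.mem := rfl

@[simp] theorem State.reg_setMem (s : State) (a x : ℕ) : (s.setMem a x).reg = s.reg := rfl

theorem State.mem_setMem (s : State) (a x r : ℕ) :
    (s.setMem a x).mem r = if r = a then x else s.mem r := by
  simp [State.setMem, Function.update_apply]

/-- The program `p` started in the state `s` halts after at most `T` steps in a state that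
satisfies `Q`. -/
def Runs (W : ℕ) (p : Prog) (s : State) (T : ℕ) (Q : State → Prop) : Prop :=
  ∃ t s', Exec W p s t s' ∧ t ≤ T ∧ Q s'

variable {W : ℕ} {s : State} {Q : State → Prop}

theorem Runs.mono {p : Prog} {T T' : ℕ} {Q' : State → Prop} (h : Runs W p s T Q) (hT : T ≤ T')
    (hQ : ∀ s', Q s' → Q' s') : Runs W p s T' Q' := by
  obtain ⟨t, s', h1, h2, h3⟩ := h
  exact ⟨t, s', h1, h2.trans hT, hQ _ h3⟩

theorem Runs.const {d n : ℕ} (h : n < W) (hQ : Q (s.setReg d n)) : Runs W (.const d n) s 1 Q :=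
  ⟨1, _, .const s d n h, le_rfl, hQ⟩

theorem Runs.copy {d a : ℕ} (h : s.reg a < W) (hQ : Q (s.setReg d (s.reg a))) :
    Runs W (.copy d a) s 1 Q :=
  ⟨1, _, .copy s d a h, le_rfl, hQ⟩

theorem Runs.arith {op : Op} {d a b : ℕ} (h : op.eval (s.reg a) (s.reg b) < W)
    (hQ : Q (s.setReg d (op.eval (s.reg a) (s.reg b)))) : Runs W (.arith op d a b) s 1 Q :=
  ⟨1, _, .arith s op d a b h, le_rfl, hQ⟩

theorem Runs.load {d a : ℕ} (h : s.mem (s.reg a) < W) (hQ : Q (s.setReg d (s.mem (s.reg a)))) :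
    Runs W (.load d a) s 1 Q :=
  ⟨1, _, .load s d a h, le_rfl, hQ⟩

theorem Runs.store {a b : ℕ} (hQ : Q (s.setMem (s.reg a) (s.reg b))) :
    Runs W (.store a b) s 1 Q :=
  ⟨1, _, .store s a b, le_rfl, hQ⟩

/-- The run of `q` is the postcondition of `p`, so a straight-line program is verified by nesting
these rules, as in a weakest-precondition calculus. -/
theorem Runs.seq {p q : Prog} {T T' : ℕ} (h : Runs W p s T fun s' => Runs W q s' T' Q) :
    Runs W (.seq p q) s (T + T') Q := by
  obtain ⟨t, s', h1, h2, t', s'', h3, h4, h5⟩ := h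
  exact ⟨t + t', s'', .seq h1 h3, by omega, h5⟩

theorem Runs.ite {c : Test} {p q : Prog} {T : ℕ} (hp : c.Holds s → Runs W p s T Q)
    (hq : ¬ c.Holds s → Runs W q s T Q) : Runs W (.ite c p q) s (T + 1) Q := by
  by_cases hc : c.Holds s
  · obtain ⟨t, s', h1, h2, h3⟩ := hp hc
    exact ⟨t + 1, s', .ite_true hc h1, by omega, h3⟩
  · obtain ⟨t, s', h1, h2, h3⟩ := hq hc
    exact ⟨t + 1, s', .ite_false hc h1, by omega, h3⟩

/-- A loop with counter `i` and limit `n`. -/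
theorem Runs.loop {body : Prog} {i n N c : ℕ} (Inv : ℕ → State → Prop)
    (hreg : ∀ k s, Inv k s → s.reg i = k ∧ s.reg n = N)
    (hbody : ∀ k < N, ∀ s, Inv k s → Runs W body s c (Inv (k + 1))) (h0 : Inv 0 s) :
    Runs W (.while (.lt i n) body) s (N * (c + 1) + 1) (Inv N) := by
  suffices H : ∀ m k s, k + m = N → Inv k s →
      Runs W (.while (.lt i n) body) s (m * (c + 1) + 1) (Inv N) from H N 0 s (by omega) h0
  intro m
  induction m with
  | zero =>
    intro k s hk hs
    obtain rfl : k = N := by omega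
    refine ⟨1, s, .while_false ?_, by omega, hs⟩
    simp [Test.Holds, hreg k s hs]
  | succ m ih =>
    intro k s hk hs
    obtain ⟨t, s', h1, h2, h3⟩ := hbody k (by omega) s hs
    obtain ⟨t', s'', h1', h2', h3'⟩ := ih (k + 1) s' (by omega) h3
    refine ⟨t + t' + 1, s'', .while_true ?_ h1 h1', ?_, h3'⟩
    · simp only [Test.Holds, hreg k s hs]; omega
    · rw [Nat.succ_mul]; omega

/-- The states `s` and `s'` agree in the memory and in the registers below `b`. -/
def AgreeBelow (b : ℕ) (s s' : State) : Prop :=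
  s'.mem = s.mem ∧ ∀ r < b, s'.reg r = s.reg r

theorem AgreeBelow.refl (b : ℕ) (s : State) : AgreeBelow b s s := ⟨rfl, fun _ _ => rfl⟩

theorem AgreeBelow.trans {b : ℕ} {s s' s'' : State} (h : AgreeBelow b s s')
    (h' : AgreeBelow b s' s'') : AgreeBelow b s s'' :=
  ⟨h'.1.trans h.1, fun r hr => (h'.2 r hr).trans (h.2 r hr)⟩

theorem AgreeBelow.mono {b c : ℕ} {s s' : State} (h : AgreeBelow c s s') (hb : b ≤ c) :
    AgreeBelow b s s' :=
  ⟨h.1, fun r hr => h.2 r (hr.trans_le hb)⟩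

theorem AgreeBelow.setReg {b d x : ℕ} {s s' : State} (h : AgreeBelow b s s') (hd : b ≤ d) :
    AgreeBelow b s (s'.setReg d x) :=
  ⟨h.1, fun r hr => by rw [State.reg_setReg, if_neg (by omega)]; exact h.2 r hr⟩

/-- The program `p` writes the value `x` into register `b` and changes neither the memory nor the
registers below `b`. -/
def Evaluates (W b : ℕ) (p : Prog) (s : State) (T x : ℕ) : Prop :=
  Runs W p s T fun s' => s'.reg b = x ∧ AgreeBelow b s s'

/-- The program that adds up the values which `p` computes in register `b + 2` while register
`b + 1` runs through the numbers below the content of register `1`. -/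
def sumProg (b : ℕ) (p : Prog) : Prog :=
  .seq (.const b 0) (.seq (.const (b + 1) 0) (.while (.lt (b + 1) 1)
    (.seq p (.seq (.arith .add b b (b + 2)) (.arith .add (b + 1) (b + 1) 3)))))

/-- `Pre` may mention any register below `b`, in particular the counters of enclosing loops; this is
what lets sums be nested. Partial sums never exceed the total, so the bound on the total excludes
overflow. -/
theorem evaluates_sumProg {v b T : ℕ} {p : Prog} (hb : 4 ≤ b) (Pre : State → Prop)
    (hPre : ∀ s s', Pre s → AgreeBelow b s s' → Pre s')
    (hreg : ∀ s, Pre s → s.reg 1 = v ∧ s.reg 3 = 1) (G : Fin v → ℕ)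
    (hp : ∀ (x : Fin v) (s : State), Pre s → s.reg (b + 1) = x → Evaluates W (b + 2) p s T (G x))
    (hG : ∑ x, G x < W) (hv : v < W) (hs : Pre s) :
    Evaluates W b (sumProg b p) s (v * (T + 3) + 3) (∑ x, G x) := by
  set G' : ℕ → ℕ := fun n => if h : n < v then G ⟨n, h⟩ else 0 with hG'
  have hsum : ∑ x, G x = ∑ n ∈ Finset.range v, G' n := by
    rw [← Fin.sum_univ_eq_sum_range]
    exact Finset.sum_congr rfl fun x _ => by simp [hG']
  rw [hsum] at hG ⊢
  have : Runs W (sumProg b p) s (1 + (1 + (v * ((T + (1 + 1)) + 1) + 1)))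
      (fun s' => s'.reg b = ∑ n ∈ Finset.range v, G' n ∧ AgreeBelow b s s') := by
    refine Runs.seq (Runs.const (by omega) (Runs.seq (Runs.const (by omega) ?_)))
    refine (Runs.loop (N := v) (fun k s' => s'.reg (b + 1) = k ∧
      s'.reg b = ∑ n ∈ Finset.range k, G' n ∧ AgreeBelow b s s') ?_ ?_ ?_).mono le_rfl
      fun s' h => h.2
    · rintro k s' ⟨h1, h2, h3⟩
      exact ⟨h1, (hreg s' (hPre _ _ hs h3)).1⟩
    · rintro k hk s' ⟨h1, h2, h3⟩
      have hle : ∑ n ∈ Finset.range k, G' n + G' k ≤ ∑ n ∈ Finset.range v, G' n := by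
        rw [← Finset.sum_range_succ]
        exact Finset.sum_le_sum_of_subset (Finset.range_mono hk)
      refine Runs.seq ((hp ⟨k, hk⟩ s' (hPre _ _ hs h3) h1).mono le_rfl ?_)
      rintro s₁ ⟨h4, h5⟩
      have e1 : s₁.reg b = ∑ n ∈ Finset.range k, G' n := by rw [h5.2 b (by omega), h2]
      have e2 : s₁.reg (b + 1) = k := by rw [h5.2 (b + 1) (by omega), h1]
      have e3 : s₁.reg (b + 2) = G' k := by rw [h4]; simp [hG', hk]
      have h6 : AgreeBelow b s s₁ := h3.trans (h5.mono (by omega))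
      have e4 := (hreg s₁ (hPre _ _ hs h6)).2
      refine Runs.seq (Runs.arith ?_ (Runs.arith ?_ ⟨?_, ?_, ?_⟩))
      · simp only [Op.eval, e1, e3]; omega
      · rw [State.reg_setReg, State.reg_setReg, if_neg (by omega), if_neg (by omega), e2, e4]
        simp only [Op.eval]; omega
      · rw [State.reg_setReg, if_pos rfl, State.reg_setReg, State.reg_setReg, if_neg (by omega),
          if_neg (by omega), e2, e4]
        rfl
      · rw [State.reg_setReg, if_neg (by omega), State.reg_setReg, if_pos rfl, e1, e3,
          Finset.sum_range_succ]
        rfl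
      · exact (h6.setReg le_rfl).setReg (by omega)
    · refine ⟨by simp [State.reg_setReg], by simp [State.reg_setReg], ?_⟩
      exact ((AgreeBelow.refl b s).setReg le_rfl).setReg (by omega)
  refine this.mono ?_ fun _ h => h
  have : v * (T + (1 + 1) + 1) = v * (T + 3) := by ring
  omega

/-! ## Terms of the Steiner quasigroup -/

/-- The address at which the multiplication table of the Steiner quasigroup starts. -/
def tableBase (v : ℕ) : ℕ := 3 * v ^ 3 + 1

/-- The registers hold the order, the address of the multiplication table, and the number one; the
memory holds the multiplication table. -/
structure Ready (v : ℕ) (S : SteinerTripleSystem (Fin v)) (s : State) : Prop where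
  reg_one : s.reg 1 = v
  reg_two : s.reg 2 = tableBase v
  reg_three : s.reg 3 = 1
  table : ∀ x y : Fin v, s.mem (x * v + y + tableBase v) = S.op x y

theorem Ready.congr {v b : ℕ} {S : SteinerTripleSystem (Fin v)} {s s' : State}
    (h : Ready v S s) (hb : 4 ≤ b) (hs : AgreeBelow b s s') : Ready v S s' where
  reg_one := by rw [hs.2 _ (by omega), h.reg_one]
  reg_two := by rw [hs.2 _ (by omega), h.reg_two]
  reg_three := by rw [hs.2 _ (by omega), h.reg_three]
  table x y := by rw [hs.1, h.table]

/-- Words below (v + 2)^4 can hold every address of the table. The table starts at 3v^3 + 1 because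
at most v^3 blocks of three input words are read after cell 0. -/
theorem tableBase_add_lt (v : ℕ) : v * v + v + tableBase v < (v + 2) ^ 4 := by
  unfold tableBase
  ring_nf
  nlinarith [Nat.zero_le (v ^ 3), Nat.zero_le (v ^ 4), Nat.zero_le (v ^ 2)]

theorem index_lt {v : ℕ} (x y : Fin v) : x * v + y < (v * v + v : ℕ) := by
  have : (x : ℕ) * v ≤ v * v := Nat.mul_le_mul_right _ x.2.le
  omega

/-- Terms in three variables in the language of Steiner quasigroups. -/
inductive Term
  | var (i : Fin 3)
  | op (t u : Term)

namespace Term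

noncomputable def eval {v : ℕ} (S : SteinerTripleSystem (Fin v)) (g : Fin 3 → Fin v) :
    Term → Fin v
  | var i => g i
  | op t u => S.op (t.eval S g) (u.eval S g)

/-- The program that evaluates a term in register `b` if the variables are in the registers
`r i`. -/
def prog (r : Fin 3 → ℕ) : Term → ℕ → Prog
  | var i, b => .copy b (r i)
  | op t u, b => .seq (t.prog r b) (.seq (u.prog r (b + 1)) (.seq (.arith .mul b b 1)
      (.seq (.arith .add b b (b + 1)) (.seq (.arith .add b b 2) (.load b b)))))

def cost : Term → ℕ
  | var _ => 1
  | op t u => t.cost + (u.cost + (1 + (1 + (1 + 1))))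

/-- The registers from `b` on serve as a stack: the value of the left subterm stays in `b` while the
right one is evaluated from `b + 1` on. -/
theorem evaluates_prog {v : ℕ} {S : SteinerTripleSystem (Fin v)} (hW : (v + 2) ^ 4 ≤ W)
    {r : Fin 3 → ℕ} {g : Fin 3 → Fin v} (t : Term) {b : ℕ} (hb : 4 ≤ b) {s : State}
    (hs : Ready v S s) (hr : ∀ i, r i < b) (hg : ∀ i, s.reg (r i) = g i) :
    Evaluates W b (t.prog r b) s t.cost (t.eval S g) := by
  have hlt := tableBase_add_lt v
  induction t generalizing b s with
  | var i =>
    refine Runs.copy ?_ ⟨by rw [State.reg_setReg, if_pos rfl, hg]; rfl,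
      (AgreeBelow.refl b s).setReg le_rfl⟩
    have := (g i).2
    rw [hg]
    omega
  | op t u iht ihu =>
    refine Runs.seq ((iht hb hs hr hg).mono le_rfl ?_)
    rintro s₁ ⟨h1, h2⟩
    refine Runs.seq ((ihu (b := b + 1) (by omega) (hs.congr hb h2)
      (fun i => (hr i).trans (by omega)) fun i => by rw [h2.2 _ (hr i), hg]).mono le_rfl ?_)
    rintro s₂ ⟨h3, h4⟩
    have h5 := h2.trans (h4.mono (Nat.le_succ b))
    have hs₂ := hs.congr hb h5
    have e1 : s₂.reg b = t.eval S g := by rw [h4.2 b (by omega), h1]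
    have hi := index_lt (t.eval S g) (u.eval S g)
    have e5 : (s₂.setReg b (t.eval S g * v + u.eval S g + tableBase v)).mem
        (t.eval S g * v + u.eval S g + tableBase v) = S.op (t.eval S g) (u.eval S g) := by
      rw [State.mem_setReg, hs₂.table]
    have n1 : (1 : ℕ) ≠ b := by omega
    have n2 : (2 : ℕ) ≠ b := by omega
    refine Runs.seq (Runs.arith ?_ (Runs.seq (Runs.arith ?_ (Runs.seq (Runs.arith ?_
      (Runs.load ?_ ⟨?_, ?_⟩)))))) <;>
      simp only [State.reg_setReg, State.mem_setReg, Op.eval, e1, h3, hs₂.reg_one, hs₂.reg_two,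
        if_neg n2, if_true, Nat.add_eq_left, one_ne_zero, if_false,
        hs₂.table]
    · omega
    · omega
    · omega
    · have := (S.op (t.eval S g) (u.eval S g)).2
      omega
    · rfl
    · exact (((h5.setReg le_rfl).setReg le_rfl).setReg le_rfl).setReg le_rfl

end Term

/-- The program that decides in register `b` whether equations between terms hold. -/
def checkProg (r : Fin 3 → ℕ) : List (Term × Term) → ℕ → Prog
  | [], b => .const b 1
  | e :: l, b => .seq (e.1.prog r b) (.seq (e.2.prog r (b + 1))
      (.ite (.eq b (b + 1)) (checkProg r l b) (.const b 0)))

def checkCost : List (Term × Term) → ℕ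
  | [] => 1
  | e :: l => e.1.cost + (e.2.cost + (checkCost l + 1 + 1))

open Classical in
theorem evaluates_checkProg {v : ℕ} {S : SteinerTripleSystem (Fin v)} (hW : (v + 2) ^ 4 ≤ W)
    {r : Fin 3 → ℕ} {g : Fin 3 → Fin v} (l : List (Term × Term)) {b : ℕ} (hb : 4 ≤ b) {s : State}
    (hs : Ready v S s) (hr : ∀ i, r i < b) (hg : ∀ i, s.reg (r i) = g i) :
    Evaluates W b (checkProg r l b) s (checkCost l)
      (if ∀ e ∈ l, e.1.eval S g = e.2.eval S g then 1 else 0) := by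
  have hlt := tableBase_add_lt v
  have h1W : 1 < W := by unfold tableBase at hlt; omega
  induction l generalizing s with
  | nil =>
    refine Runs.const h1W ⟨?_, (AgreeBelow.refl b s).setReg le_rfl⟩
    simp [State.reg_setReg]
  | cons e l ih =>
    refine Runs.seq ((e.1.evaluates_prog hW hb hs hr hg).mono le_rfl ?_)
    rintro s₁ ⟨h1, h2⟩
    refine Runs.seq ((e.2.evaluates_prog hW (b := b + 1) (g := g) (by omega) (hs.congr hb h2)
      (fun i => (hr i).trans (by omega)) fun i => by rw [h2.2 _ (hr i), hg]).mono le_rfl ?_)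
    rintro s₂ ⟨h3, h4⟩
    have h5 := h2.trans (h4.mono (Nat.le_succ b))
    have hs₂ := hs.congr hb h5
    have e1 : s₂.reg b = e.1.eval S g := by rw [h4.2 b (by omega), h1]
    have hiff : Test.Holds (.eq b (b + 1)) s₂ ↔ e.1.eval S g = e.2.eval S g := by
      simp only [Test.Holds, e1, h3, Fin.ext_iff]
    refine Runs.ite (fun h => ?_) fun h => ?_
    · refine (ih hs₂ fun i => by rw [h5.2 _ (hr i), hg]).mono (by omega) ?_
      rintro s₃ ⟨h6, h7⟩
      refine ⟨?_, h5.trans h7⟩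
      rw [h6]
      simp [hiff.1 h]
    · refine (Runs.const (by omega) ⟨?_, h5.setReg le_rfl⟩).mono (Nat.le_add_left _ _)
        fun _ h => h
      rw [State.reg_setReg, if_pos rfl, if_neg]
      exact fun h' => h (hiff.2 (h' e (by simp)))

/-! ## Functions of Steiner triple systems that are computed from the multiplication table -/

/-- The function `f` is computed from the multiplication table in cubic time, in any
register from `5` on. -/
def CubicTime (f : (v : ℕ) → SteinerTripleSystem (Fin v) → ℕ) : Prop :=
  ∀ b, 5 ≤ b → ∃ (p : Prog) (k c : ℕ), ∀ (v : ℕ) (S : SteinerTripleSystem (Fin v)),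
    f v S < (v + 2) ^ k ∧ ∀ (W : ℕ) (s : State), (v + 2) ^ k ≤ W → Ready v S s →
      Evaluates W b p s (c * (v + 1) ^ 3) (f v S)

namespace CubicTime

variable {f g : (v : ℕ) → SteinerTripleSystem (Fin v) → ℕ}

theorem one : CubicTime fun _ _ => 1 := by
  intro b hb
  refine ⟨.const b 1, 1, 1, fun v S => ⟨by beta_reduce; rw [pow_one]; omega, fun W s hW hs => ?_⟩⟩
  rw [pow_one] at hW
  have hW1 : 1 < W := by omega
  refine (Runs.const hW1 ⟨by simp [State.reg_setReg],
    (AgreeBelow.refl b s).setReg le_rfl⟩).mono ?_ fun _ h => h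
  have := Nat.one_le_pow 3 (v + 1) (by omega)
  omega

theorem order_mul (hf : CubicTime f) : CubicTime fun v S => v * f v S := by
  intro b hb
  obtain ⟨p, k, c, h⟩ := hf b hb
  refine ⟨.seq p (.arith .mul b 1 b), k + 1, c + 1, fun v S => ?_⟩
  obtain ⟨hlt, h⟩ := h v S
  have hlt' : v * f v S < (v + 2) ^ (k + 1) := by
    rw [pow_succ, mul_comm]
    exact Nat.mul_lt_mul_of_lt_of_le hlt (by omega) (by omega)
  have hk : (v + 2) ^ k ≤ (v + 2) ^ (k + 1) := Nat.pow_le_pow_right (by omega) (by omega)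
  have h3 := Nat.one_le_pow 3 (v + 1) (by omega)
  refine ⟨hlt', fun W s hW hs => Runs.mono (T := c * (v + 1) ^ 3 + 1) (Runs.seq
    ((h W s (hk.trans hW) hs).mono le_rfl ?_)) (by rw [Nat.succ_mul]; omega) fun _ h => h⟩
  rintro s₁ ⟨h1, h2⟩
  have e1 := (hs.congr (by omega) h2).reg_one
  refine Runs.arith ?_ ⟨?_, h2.setReg le_rfl⟩
  · rw [e1, h1]; exact hlt'.trans_le hW
  · rw [State.reg_setReg, if_pos rfl, e1, h1]; rfl

theorem sub (hf : CubicTime f) (hg : CubicTime g) : CubicTime fun v S => f v S - g v S := by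
  intro b hb
  obtain ⟨p, k, c, h⟩ := hf b hb
  obtain ⟨q, l, d, h'⟩ := hg (b + 1) (by omega)
  refine ⟨.seq p (.seq q (.arith .sub b b (b + 1))), k + l, c + (d + 1), fun v S => ?_⟩
  obtain ⟨hlt, h⟩ := h v S
  obtain ⟨-, h'⟩ := h' v S
  have hk : (v + 2) ^ k ≤ (v + 2) ^ (k + l) := Nat.pow_le_pow_right (by omega) (by omega)
  have hl : (v + 2) ^ l ≤ (v + 2) ^ (k + l) := Nat.pow_le_pow_right (by omega) (by omega)
  have h3 := Nat.one_le_pow 3 (v + 1) (by omega)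
  refine ⟨by dsimp only; omega, fun W s hW hs => Runs.mono (T := c * (v + 1) ^ 3 + (d * (v + 1) ^ 3 + 1))
    (Runs.seq ((h W s (hk.trans hW) hs).mono le_rfl ?_)) ?_ fun _ h => h⟩
  · rintro s₁ ⟨h1, h2⟩
    refine Runs.seq ((h' W s₁ (hl.trans hW) (hs.congr (by omega) h2)).mono le_rfl ?_)
    rintro s₂ ⟨h4, h5⟩
    have e1 : s₂.reg b = f v S := by rw [h5.2 b (by omega), h1]
    refine Runs.arith ?_ ⟨?_, (h2.trans (h5.mono (by omega))).setReg le_rfl⟩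
    · simp only [Op.eval, e1, h4]; omega
    · rw [State.reg_setReg, if_pos rfl, e1, h4]; rfl
  · rw [Nat.add_mul, Nat.succ_mul]; omega

theorem div_const (hf : CubicTime f) (n : ℕ) : CubicTime fun v S => f v S / n := by
  intro b hb
  obtain ⟨p, k, c, h⟩ := hf b hb
  refine ⟨.seq p (.seq (.const (b + 1) n) (.arith .div b b (b + 1))), k + n, c + 2, fun v S => ?_⟩
  obtain ⟨hlt, h⟩ := h v S
  have hk : (v + 2) ^ k ≤ (v + 2) ^ (k + n) := Nat.pow_le_pow_right (by omega) (by omega)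
  -- The divisor itself must fit into a word, even for v = 0; n < 2^n explains the exponent `k + n`.
  have hn : n < (v + 2) ^ (k + n) :=
    (Nat.lt_pow_self (by omega)).trans_le (Nat.pow_le_pow_right (by omega) (by omega))
  have h3 := Nat.one_le_pow 3 (v + 1) (by omega)
  have hd := Nat.div_le_self (f v S) n
  refine ⟨by dsimp only; omega, fun W s hW hs => Runs.mono (T := c * (v + 1) ^ 3 + (1 + 1))
    (Runs.seq ((h W s (hk.trans hW) hs).mono le_rfl ?_)) ?_ fun _ h => h⟩
  · rintro s₁ ⟨h1, h2⟩
    refine Runs.seq (Runs.const (by omega) (Runs.arith ?_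
      ⟨?_, (h2.setReg (by omega)).setReg le_rfl⟩)) <;>
      simp only [State.reg_setReg, Op.eval, h1, if_true, Nat.left_eq_add, one_ne_zero, if_false]
    omega
  · rw [Nat.add_mul]; omega

open Classical in
-- This is the source of the exponent three: three nested loops run over the values of the
-- variables, and the innermost test has a cost that depends only on `l`.
theorem card_equations (l : List (Term × Term)) : CubicTime fun v S =>
    Nat.card {g : Fin 3 → Fin v // ∀ e ∈ l, e.1.eval S g = e.2.eval S g} := by
  intro b hb
  -- The accumulators of the three sums are in `b`, `b + 2`, `b + 4` and the result of the test is
  -- in `b + 6`; the loop counters in between are the variables.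
  set r : Fin 3 → ℕ := ![b + 1, b + 3, b + 5] with hr
  refine ⟨sumProg b (sumProg (b + 2) (sumProg (b + 4) (checkProg r l (b + 6)))), 4,
    checkCost l + 3 + 3 + 3 + 3, fun v S => ?_⟩
  set G : Fin v → Fin v → Fin v → ℕ := fun x y z =>
    if ∀ e ∈ l, e.1.eval S ![x, y, z] = e.2.eval S ![x, y, z] then 1 else 0 with hG
  have hcard : Nat.card {g : Fin 3 → Fin v // ∀ e ∈ l, e.1.eval S g = e.2.eval S g} =
      ∑ x, ∑ y, ∑ z, G x y z := by
    rw [Nat.card_eq_fintype_card, Fintype.card_subtype, Finset.card_filter,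
      ← Fintype.sum_prod_type', ← Fintype.sum_prod_type']
    refine Fintype.sum_equiv
      ⟨fun g => ((g 0, g 1), g 2), fun w => ![w.1.1, w.1.2, w.2], fun g => ?_, fun w => rfl⟩ _ _
      fun g => ?_
    · ext i; fin_cases i <;> rfl
    · have : ![g 0, g 1, g 2] = g := by ext i; fin_cases i <;> rfl
      change _ = G (g 0) (g 1) (g 2)
      simp only [hG, this]
  have hG1 : ∀ x y z, G x y z ≤ 1 := fun x y z => by simp only [hG]; split_ifs <;> omega
  have hG2 : ∀ x y, ∑ z, G x y z ≤ v := fun x y => by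
    simpa using Finset.sum_le_card_nsmul Finset.univ (G x y) 1 fun z _ => hG1 x y z
  have hG3 : ∀ x, ∑ y, ∑ z, G x y z ≤ v * v := fun x => by
    simpa using Finset.sum_le_card_nsmul Finset.univ (fun y => ∑ z, G x y z) v fun y _ => hG2 x y
  have hG4 : ∑ x, ∑ y, ∑ z, G x y z ≤ v * (v * v) := by
    simpa using Finset.sum_le_card_nsmul Finset.univ (fun x => ∑ y, ∑ z, G x y z) (v * v)
      fun x _ => hG3 x
  have hlt := tableBase_add_lt v
  have hv3 : v * (v * v) < (v + 2) ^ 4 := by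
    unfold tableBase at hlt
    have : v * (v * v) = v ^ 3 := by ring
    omega
  beta_reduce
  rw [hcard]
  refine ⟨hG4.trans_lt hv3, fun W s hW hs => ?_⟩
  refine Runs.mono (T := v * ((v * ((v * (checkCost l + 3) + 3) + 3) + 3) + 3) + 3) ?_ ?_
    fun _ h => h
  · refine evaluates_sumProg (by omega) (Ready v S) (fun s s' h h' => h.congr (by omega) h')
      (fun s h => ⟨h.reg_one, h.reg_three⟩) (fun x => ∑ y, ∑ z, G x y z) (fun x s hs hx => ?_)
      (by omega) (by omega) hs
    refine evaluates_sumProg (by omega) (fun s => Ready v S s ∧ s.reg (b + 1) = x)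
      (fun s s' h h' => ⟨h.1.congr (by omega) h', by rw [h'.2 _ (by omega), h.2]⟩)
      (fun s h => ⟨h.1.reg_one, h.1.reg_three⟩) (fun y => ∑ z, G x y z)
      (fun y s hs hy => ?_) ((hG3 x).trans_lt (by omega)) (by omega) ⟨hs, hx⟩
    refine evaluates_sumProg (by omega)
      (fun s => Ready v S s ∧ s.reg (b + 1) = x ∧ s.reg (b + 3) = y)
      (fun s s' h h' => ⟨h.1.congr (by omega) h', by rw [h'.2 _ (by omega), h.2.1],
        by rw [h'.2 _ (by omega), h.2.2]⟩)
      (fun s h => ⟨h.1.reg_one, h.1.reg_three⟩) (fun z => G x y z)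
      (fun z s hs hz => ?_) ((hG2 x y).trans_lt (by omega)) (by omega) ⟨hs.1, hs.2, hy⟩
    refine evaluates_checkProg hW l (by omega) hs.1 (fun i => ?_) fun i => ?_
    · fin_cases i <;> simp [hr]
    · fin_cases i
      · exact hs.2.1
      · exact hs.2.2
      · exact hz
  · ring_nf
    nlinarith [Nat.zero_le (v ^ 3), Nat.zero_le (v ^ 2),
      Nat.zero_le (checkCost l * v ^ 2), Nat.zero_le (checkCost l * v), Nat.zero_le (checkCost l)]

end CubicTime

end RAM

/-! ## Building the multiplication table -/

section Input

variable {v : ℕ}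

theorem encodeInput_getD (L : List (Fin v × Fin v × Fin v)) (i : ℕ) :
    (encodeInput v L).getD (3 * i + 1) 0 = (L[i]?.map fun l => l.1.val).getD 0 ∧
    (encodeInput v L).getD (3 * i + 2) 0 = (L[i]?.map fun l => l.2.1.val).getD 0 ∧
    (encodeInput v L).getD (3 * i + 3) 0 = (L[i]?.map fun l => l.2.2.val).getD 0 := by
  simp only [encodeInput, List.getD_cons_succ]
  induction L generalizing i with
  | nil => simp
  | cons l L ih =>
    cases i with
    | zero => simp
    | succ i =>
      have e : 3 * (i + 1) = 3 * i + 3 := by ring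
      simpa [e] using ih i

variable {S : SteinerTripleSystem (Fin v)} {L : List (Fin v × Fin v × Fin v)}

/-- The input does not state the number of lines; this crude bound, computable from v alone, serves
as the length of the reading loop. -/
theorem IsLineListing.length_le (hL : IsLineListing S L) : L.length ≤ v ^ 3 := by
  have h : L.Nodup := hL.1.of_map _
  have := h.length_le_card
  simpa [pow_succ, mul_assoc] using this

/-- Reading past the end of the list is harmless: the blank cells give the triple 0, 0, 0, and 0 * 0
= 0 is a correct product. -/
theorem IsLineListing.encodeInput_rel (hL : IsLineListing S L) {i : ℕ} (hi : i < v ^ 3) :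
    ∃ x y z : Fin v, S.op x y = z ∧ (encodeInput v L).getD (3 * i + 1) 0 = x ∧
      (encodeInput v L).getD (3 * i + 2) 0 = y ∧ (encodeInput v L).getD (3 * i + 3) 0 = z := by
  obtain ⟨h1, h2, h3⟩ := encodeInput_getD L i
  rw [h1, h2, h3]
  by_cases h : i < L.length
  · refine ⟨L[i].1, L[i].2.1, L[i].2.2, ?_, by simp [h], by simp [h], by simp [h]⟩
    have hmem : ({L[i].1, L[i].2.1, L[i].2.2} : Finset (Fin v)) ∈ S.lines :=
      (hL.2 _).2 (List.mem_map.2 ⟨L[i], List.getElem_mem h, rfl⟩)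
    obtain ⟨h4, h5, h6⟩ := Finset.ne_of_card_triple_eq_three (S.card_line _ hmem)
    exact S.op_eq_iff.2 (Or.inr ⟨h4, h6, h5, hmem⟩)
  · have hv : 0 < v := by
      rcases Nat.eq_zero_or_pos v with rfl | hv
      · simp at hi
      · exact hv
    refine ⟨⟨0, hv⟩, ⟨0, hv⟩, ⟨0, hv⟩, S.op_self _, ?_, ?_, ?_⟩ <;>
      simp [List.getElem?_eq_none (not_lt.1 h)]

theorem IsLineListing.exists_index (hL : IsLineListing S L) {x y : Fin v} (hxy : x ≠ y) :
    ∃ i < v ^ 3, ∃ a b c : Fin v, (encodeInput v L).getD (3 * i + 1) 0 = a ∧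
      (encodeInput v L).getD (3 * i + 2) 0 = b ∧ (encodeInput v L).getD (3 * i + 3) 0 = c ∧
      (x = a ∨ x = b ∨ x = c) ∧ (y = a ∨ y = b ∨ y = c) := by
  obtain ⟨B, ⟨hB, hx, hy⟩, -⟩ := S.existsUnique_line x y hxy
  obtain ⟨l, hl, rfl⟩ := List.mem_map.1 ((hL.2 B).1 hB)
  obtain ⟨i, hi, rfl⟩ := List.getElem_of_mem hl
  obtain ⟨h1, h2, h3⟩ := encodeInput_getD L i
  refine ⟨i, hi.trans_le hL.length_le, L[i].1, L[i].2.1, L[i].2.2, by rw [h1]; simp [hi],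
    by rw [h2]; simp [hi], by rw [h3]; simp [hi], by simpa using hx, by simpa using hy⟩

end Input

namespace RAM

variable {W v : ℕ} {S : SteinerTripleSystem (Fin v)}

/-- The table in the memory `m` contains the product of `x` and `y`. -/
def HasEntry (S : SteinerTripleSystem (Fin v)) (m : ℕ → ℕ) (x y : Fin v) : Prop :=
  m (x * v + y + tableBase v) = S.op x y

/-- The memory `m'` has all correct table entries of the memory `m` and the same cells below the
table. -/
def Extends (S : SteinerTripleSystem (Fin v)) (m m' : ℕ → ℕ) : Prop :=
  (∀ a < tableBase v, m' a = m a) ∧ ∀ x y, HasEntry S m x y → HasEntry S m' x y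

theorem Extends.refl (m : ℕ → ℕ) : Extends S m m := ⟨fun _ _ => rfl, fun _ _ h => h⟩

theorem Extends.trans {m m' m'' : ℕ → ℕ} (h : Extends S m m') (h' : Extends S m' m'') :
    Extends S m m'' :=
  ⟨fun a ha => (h'.1 a ha).trans (h.1 a ha), fun x y hxy => h'.2 x y (h.2 x y hxy)⟩

theorem index_injective {x y x' y' : Fin v} (h : (x * v + y : ℕ) = x' * v + y') :
    x = x' ∧ y = y' := by
  have hv : 0 < v := x.pos
  have h1 := congrArg (· / v) h
  have h2 := congrArg (· % v) h
  simp only [mul_comm _ v, Nat.mul_add_div hv, Nat.div_eq_of_lt y.2, Nat.div_eq_of_lt y'.2,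
    add_zero, Nat.mul_add_mod, Nat.mod_eq_of_lt y.2, Nat.mod_eq_of_lt y'.2] at h1 h2
  exact ⟨Fin.ext h1, Fin.ext h2⟩

/-- The program that enters register `c` as the product of the registers `a` and `b`. -/
def putProg (a b c : ℕ) : Prog :=
  .seq (.arith .mul 4 a 1) (.seq (.arith .add 4 4 b) (.seq (.arith .add 4 4 2) (.store 4 c)))

theorem runs_putProg (hW : (v + 2) ^ 4 ≤ W) {a b c : ℕ} (hb : b ≠ 4) (hc : c ≠ 4)
    {s : State} (h1 : s.reg 1 = v) (h2 : s.reg 2 = tableBase v) {x y : Fin v}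
    (hx : s.reg a = x) (hy : s.reg b = y) (hz : s.reg c = S.op x y) :
    Runs W (putProg a b c) s 4 fun s' =>
      (∀ r, r ≠ 4 → s'.reg r = s.reg r) ∧ Extends S s.mem s'.mem ∧ HasEntry S s'.mem x y := by
  have hlt := tableBase_add_lt v
  have hi := index_lt x y
  refine Runs.seq (Runs.arith ?_ (Runs.seq (Runs.arith ?_ (Runs.seq (Runs.arith ?_
      (Runs.store ⟨?_, ?_, ?_⟩)))))) <;>
    simp only [State.reg_setReg, Op.eval, State.reg_setMem, if_true, hx, hy, hz,
      h1, h2, if_neg hb, if_neg hc, Nat.reduceEqDiff, if_false]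
  · omega
  · omega
  · omega
  · intro r hr
    simp [hr]
  · refine ⟨fun k hk => ?_, fun x' y' h => ?_⟩
    · rw [State.mem_setMem, if_neg (by omega)]; rfl
    · unfold HasEntry
      rw [State.mem_setMem]
      -- A cell that is overwritten belongs to the same pair of points, so it receives the same
      -- product again.
      split_ifs with heq
      · obtain ⟨rfl, rfl⟩ := index_injective (Nat.add_right_cancel heq)
        rfl
      · exact h
  · unfold HasEntry
    rw [State.mem_setMem, if_pos rfl]

def putsProg : List (ℕ × ℕ × ℕ) → Prog
  | [] => .skip
  | e :: l => .seq (putProg e.1 e.2.1 e.2.2) (putsProg l)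

theorem runs_putsProg (hW : (v + 2) ^ 4 ≤ W) (f : ℕ → Fin v) (l : List (ℕ × ℕ × ℕ))
    (hl : ∀ e ∈ l, e.1 ≠ 4 ∧ e.2.1 ≠ 4 ∧ e.2.2 ≠ 4 ∧ S.op (f e.1) (f e.2.1) = f e.2.2)
    {s : State} (h1 : s.reg 1 = v) (h2 : s.reg 2 = tableBase v)
    (hf : ∀ e ∈ l, s.reg e.1 = f e.1 ∧ s.reg e.2.1 = f e.2.1 ∧ s.reg e.2.2 = f e.2.2) :
    Runs W (putsProg l) s (l.length * 4 + 1) fun s' =>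
      (∀ r, r ≠ 4 → s'.reg r = s.reg r) ∧ Extends S s.mem s'.mem ∧
        ∀ e ∈ l, HasEntry S s'.mem (f e.1) (f e.2.1) := by
  induction l generalizing s with
  | nil => exact ⟨1, s, .skip s, by simp, fun _ _ => rfl, .refl _, by simp⟩
  | cons e l ih =>
    obtain ⟨g1, g2, g3, g4⟩ := hl e (by simp)
    obtain ⟨k1, k2, k3⟩ := hf e (by simp)
    refine Runs.mono (T := 4 + (l.length * 4 + 1)) (Runs.seq
      ((runs_putProg (S := S) hW g2 g3 h1 h2 k1 k2 (by rw [k3, g4])).mono le_rfl ?_))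
      (by simp only [List.length_cons]; omega) fun _ h => h
    rintro s₁ ⟨m1, m2, m3⟩
    refine (ih (fun e he => hl e (by simp [he])) (by rw [m1 _ (by omega), h1])
      (by rw [m1 _ (by omega), h2]) fun e he => ?_).mono le_rfl ?_
    · obtain ⟨n1, n2, n3, -⟩ := hl e (by simp [he])
      rw [m1 _ n1, m1 _ n2, m1 _ n3]
      exact hf e (by simp [he])
    · rintro s₂ ⟨n1, n2, n3⟩
      refine ⟨fun r hr => (n1 r hr).trans (m1 r hr), m2.trans n2, fun e' he' => ?_⟩
      rcases List.mem_cons.1 he' with rfl | he'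
      · exact n2.2 _ _ m3
      · exact n3 e' he'

/-- The program that reads the order and computes the address of the table. -/
def setupProg : Prog :=
  .seq (.load 1 0) (.seq (.const 3 1) (.seq (.arith .mul 2 1 1) (.seq (.arith .mul 2 2 1)
    (.seq (.copy 5 2) (.seq (.const 4 3) (.seq (.arith .mul 2 2 4) (.arith .add 2 2 3)))))))

theorem runs_setupProg (hW : (v + 2) ^ 4 ≤ W) {s : State} (h0 : s.mem (s.reg 0) = v) :
    Runs W setupProg s 8 fun s' => s'.reg 1 = v ∧ s'.reg 2 = tableBase v ∧ s'.reg 3 = 1 ∧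
      s'.reg 5 = v ^ 3 ∧ s'.mem = s.mem := by
  have hlt := tableBase_add_lt v
  have hbase : tableBase v = v * v * v * 3 + 1 := by unfold tableBase; ring
  have h3 : v ^ 3 = v * v * v := by ring
  have h4 : 3 < W := by
    refine lt_of_lt_of_le ?_ hW
    calc 3 < 2 ^ 4 := by norm_num
      _ ≤ (v + 2) ^ 4 := Nat.pow_le_pow_left (by omega) 4
  refine Runs.seq (Runs.load ?_ (Runs.seq (Runs.const ?_ (Runs.seq (Runs.arith ?_ (Runs.seq
    (Runs.arith ?_ (Runs.seq (Runs.copy ?_ (Runs.seq (Runs.const ?_ (Runs.seq (Runs.arith ?_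
      (Runs.arith ?_ ?_)))))))))))))) <;>
    (try simp only [State.reg_setReg, State.mem_setReg, Op.eval, if_true, h0,
      Nat.reduceEqDiff, if_false, OfNat.one_ne_ofNat, OfNat.ofNat_ne_one, hbase, h3, and_self]) <;>
    omega

/-- The program that enters all products of two different points. -/
def linesProg : Prog :=
  .seq (.const 6 0) (.seq (.const 10 1) (.while (.lt 6 5)
    (.seq (.load 7 10) (.seq (.arith .add 10 10 3) (.seq (.load 8 10) (.seq (.arith .add 10 10 3)
      (.seq (.load 9 10) (.seq (.arith .add 10 10 3) (.seq (.arith .add 6 6 3)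
        (putsProg [(7, 8, 9), (8, 7, 9), (7, 9, 8), (9, 7, 8), (8, 9, 7), (9, 8, 7)]))))))))))

theorem runs_linesProg (hW : (v + 2) ^ 4 ≤ W) {L : List (Fin v × Fin v × Fin v)}
    (hL : IsLineListing S L) {s : State} (h1 : s.reg 1 = v) (h2 : s.reg 2 = tableBase v)
    (h3 : s.reg 3 = 1) (h5 : s.reg 5 = v ^ 3) (hmem : s.mem = fun a => (encodeInput v L).getD a 0) :
    Runs W linesProg s (v ^ 3 * 33 + 3) fun s' => s'.reg 1 = v ∧ s'.reg 2 = tableBase v ∧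
      s'.reg 3 = 1 ∧ ∀ x y : Fin v, x ≠ y → HasEntry S s'.mem x y := by
  have hlt := tableBase_add_lt v
  have hbase : tableBase v = 3 * v ^ 3 + 1 := rfl
  set rd := fun a => (encodeInput v L).getD a 0 with hrd
  -- The table lies above the input, so the input cells survive and the next block can still be
  -- read. One round costs 7 steps for reading and counting and 6 * 4 + 1 for the six entries; the
  -- test adds one more.
  refine Runs.mono (T := 1 + (1 + (v ^ 3 * (32 + 1) + 1))) (Runs.seq (Runs.const (by omega)
    (Runs.seq (Runs.const (by omega) ((Runs.loop (N := v ^ 3) (fun k s' => s'.reg 6 = k ∧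
      s'.reg 5 = v ^ 3 ∧ s'.reg 1 = v ∧ s'.reg 2 = tableBase v ∧ s'.reg 3 = 1 ∧
      s'.reg 10 = 3 * k + 1 ∧ (∀ a < tableBase v, s'.mem a = rd a) ∧
      ∀ i < k, ∀ x y a b c : Fin v, x ≠ y → rd (3 * i + 1) = a → rd (3 * i + 2) = b →
        rd (3 * i + 3) = c → (x = a ∨ x = b ∨ x = c) → (y = a ∨ y = b ∨ y = c) →
        HasEntry S s'.mem x y) ?_ ?_ ?_).mono le_rfl ?_))))) (by omega) fun _ h => h
  · exact fun k s' h => ⟨h.1, h.2.1⟩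
  · rintro k hk s' ⟨g6, g5, g1, g2, g3, g10, gmem, gent⟩
    obtain ⟨x, y, z, hxyz, hx, hy, hz⟩ := hL.encodeInput_rel hk
    have m1 : s'.mem (3 * k + 1) = x := (gmem _ (by omega)).trans hx
    have m2 : s'.mem (3 * k + 1 + 1) = y := (gmem _ (by omega)).trans hy
    have m3 : s'.mem (3 * k + 1 + 1 + 1) = z := (gmem _ (by omega)).trans hz
    have lx := x.2
    have ly := y.2
    have lz := z.2
    refine Runs.mono (T := 1 + (1 + (1 + (1 + (1 + (1 + (1 + (6 * 4 + 1)))))))) (Runs.seq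
      (Runs.load ?_ (Runs.seq (Runs.arith ?_ (Runs.seq (Runs.load ?_ (Runs.seq (Runs.arith ?_
      (Runs.seq (Runs.load ?_ (Runs.seq (Runs.arith ?_ (Runs.seq (Runs.arith ?_ ((runs_putsProg
        (S := S) hW (fun r => if r = 7 then x else if r = 8 then y else z) _ ?_ ?_ ?_ ?_).mono
        le_rfl ?_))))))))))))))) (by omega) fun _ h => h
    rotate_right
    · rintro s₂ ⟨n1, n2, n3⟩
      simp only [State.mem_setReg] at n2
      have n4 : ∀ x' y' : Fin v, x' ≠ y' → (x' = x ∨ x' = y ∨ x' = z) →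
          (y' = x ∨ y' = y ∨ y' = z) → HasEntry S s₂.mem x' y' := by
        simp only [List.mem_cons, List.not_mem_nil, or_false, forall_eq_or_imp, forall_eq,
          Nat.reduceEqDiff, if_true, if_false] at n3
        obtain ⟨p1, p2, p3, p4, p5, p6⟩ := n3
        rintro x' y' hne (rfl | rfl | rfl) (rfl | rfl | rfl) <;>
          first | exact absurd rfl hne | assumption
      refine ⟨?_, ?_, ?_, ?_, ?_, ?_, fun a ha => (n2.1 a ha).trans (gmem a ha), ?_⟩
      · rw [n1 _ (by omega)]; simp [State.reg_setReg, Op.eval, g6, g3]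
      · rw [n1 _ (by omega)]; simp [State.reg_setReg, g5]
      · rw [n1 _ (by omega)]; simp [State.reg_setReg, g1]
      · rw [n1 _ (by omega)]; simp [State.reg_setReg, g2]
      · rw [n1 _ (by omega)]; simp [State.reg_setReg, g3]
      · rw [n1 _ (by omega)]; simp [State.reg_setReg, Op.eval, g3, g10]; ring
      · intro i hi x' y' a b c hne ha hb hc hx' hy'
        rcases Nat.lt_succ_iff_lt_or_eq.1 hi with hi | rfl
        · exact n2.2 _ _ (gent i hi x' y' a b c hne ha hb hc hx' hy')
        · obtain rfl : a = x := Fin.ext (ha.symm.trans hx)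
          obtain rfl : b = y := Fin.ext (hb.symm.trans hy)
          obtain rfl : c = z := Fin.ext (hc.symm.trans hz)
          exact n4 x' y' hne hx' hy'
    all_goals try simp only [State.reg_setReg, State.mem_setReg, Op.eval, if_true, g10, m1, g1, g2, g3,
      g6, m2, m3, Nat.reduceEqDiff, if_false, OfNat.one_ne_ofNat]
    iterate 7 omega
    · have q1 := S.op_swap hxyz
      have q2 := S.op_swap_right hxyz
      have q3 := S.op_swap_right q1
      have q4 := S.op_swap q2
      have q5 := S.op_swap q3
      simp [hxyz, q1, q2, q3, q4, q5]
    · simp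
  · refine ⟨?_, ?_, ?_, ?_, ?_, ?_, fun a _ => ?_, fun i hi => absurd hi (by omega)⟩ <;>
      simp [State.reg_setReg, h1, h2, h3, h5, hmem]
  · rintro s' ⟨-, -, g1, g2, g3, -, -, gent⟩
    refine ⟨g1, g2, g3, fun x y hxy => ?_⟩
    obtain ⟨i, hi, a, b, c, ha, hb, hc, hx, hy⟩ := hL.exists_index hxy
    exact gent i hi x y a b c hxy ha hb hc hx hy

/-- The program that enters all products of a point with itself. -/
def diagonalProg : Prog :=
  .seq (.const 6 0) (.while (.lt 6 1) (.seq (putProg 6 6 6) (.arith .add 6 6 3)))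

theorem runs_diagonalProg (hW : (v + 2) ^ 4 ≤ W) {s : State} (h1 : s.reg 1 = v)
    (h2 : s.reg 2 = tableBase v) (h3 : s.reg 3 = 1)
    (hmem : ∀ x y : Fin v, x ≠ y → HasEntry S s.mem x y) :
    Runs W diagonalProg s (v * 6 + 2) (Ready v S) := by
  have hlt := tableBase_add_lt v
  refine Runs.mono (T := 1 + (v * (4 + 1 + 1) + 1)) (Runs.seq (Runs.const (by omega)
    ((Runs.loop (N := v) (fun k s' => s'.reg 6 = k ∧ s'.reg 1 = v ∧ s'.reg 2 = tableBase v ∧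
      s'.reg 3 = 1 ∧ (∀ x y : Fin v, x ≠ y → HasEntry S s'.mem x y) ∧
      ∀ x : Fin v, x.val < k → HasEntry S s'.mem x x) ?_ ?_ ?_).mono le_rfl ?_)))
    (by omega) fun _ h => h
  · exact fun k s' h => ⟨h.1, h.2.1⟩
  · rintro k hk s' ⟨g6, g1, g2, g3, gmem, gdiag⟩
    refine Runs.seq ((runs_putProg (S := S) (x := ⟨k, hk⟩) (y := ⟨k, hk⟩) hW (by omega) (by omega)
      g1 g2 g6 g6 (by rw [S.op_self, g6])).mono le_rfl ?_)
    rintro s₁ ⟨n1, n2, n3⟩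
    have e6 : s₁.reg 6 = k := by rw [n1 _ (by omega), g6]
    have e3 : s₁.reg 3 = 1 := by rw [n1 _ (by omega), g3]
    refine Runs.arith ?_ ⟨?_, ?_, ?_, ?_, fun x y hxy => n2.2 _ _ (gmem x y hxy), fun x hx => ?_⟩
    · simp only [Op.eval, e6, e3]; omega
    · simp [State.reg_setReg, Op.eval, e6, e3]
    · simpa [State.reg_setReg] using (n1 _ (by omega)).trans g1
    · simpa [State.reg_setReg] using (n1 _ (by omega)).trans g2
    · simpa [State.reg_setReg] using e3
    · rcases Nat.lt_succ_iff_lt_or_eq.1 hx with hx | hx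
      · exact n2.2 _ _ (gdiag x hx)
      · obtain rfl : x = ⟨k, hk⟩ := Fin.ext hx
        exact n3
  · refine ⟨?_, ?_, ?_, ?_, hmem, fun x hx => absurd hx (by omega)⟩ <;>
      simp [State.reg_setReg, h1, h2, h3]
  · rintro s' ⟨-, g1, g2, g3, gmem, gdiag⟩
    refine ⟨g1, g2, g3, fun x y => ?_⟩
    by_cases hxy : x = y
    · subst hxy
      exact gdiag x x.2
    · exact gmem x y hxy

theorem CubicTime.computableInTime {f : (v : ℕ) → SteinerTripleSystem (Fin v) → ℕ}
    (hf : CubicTime f) : ComputableInTime f fun v => (v : ℝ) ^ 3 := by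
  obtain ⟨p, k, c, hp⟩ := hf 5 le_rfl
  -- The exponent `k` serves the counting program and 4 the table addresses. Building the table and
  -- copying the result take at most 33v^3 + 6v + 14 steps, which 60(v + 1)^3 covers.
  refine ⟨.seq setupProg (.seq linesProg (.seq diagonalProg (.seq p (.copy 0 5)))), k + 4,
    fun v => (c + 60) * (v + 1) ^ 3, ?_, fun v S L hL => ?_⟩
  · refine IsBigO.of_bound ((c + 60) * 8) ?_
    filter_upwards [eventually_ge_atTop 1] with v hv
    have hv' : (1 : ℝ) ≤ v := by exact_mod_cast hv
    push_cast
    rw [Real.norm_of_nonneg (by positivity), Real.norm_of_nonneg (by positivity), mul_assoc]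
    refine mul_le_mul_of_nonneg_left ?_ (by positivity)
    calc ((v : ℝ) + 1) ^ 3 ≤ (2 * v) ^ 3 := by gcongr; linarith
      _ = 8 * (v : ℝ) ^ 3 := by ring
  obtain ⟨hlt, hp⟩ := hp v S
  set W := (v + 2) ^ (k + 4) with hWdef
  have hW : (v + 2) ^ 4 ≤ W := Nat.pow_le_pow_right (by omega) (by omega)
  have hW' : (v + 2) ^ k ≤ W := Nat.pow_le_pow_right (by omega) (by omega)
  suffices H : Runs W (.seq setupProg (.seq linesProg (.seq diagonalProg (.seq p (.copy 0 5)))))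
      (initial (encodeInput v L))
      (8 + ((v ^ 3 * 33 + 3) + ((v * 6 + 2) + (c * (v + 1) ^ 3 + 1)))) (fun s => s.reg 0 = f v S) by
    obtain ⟨t, s, h1, h2, h3⟩ := H
    refine ⟨t, s, h1, h2.trans ?_, h3⟩
    ring_nf
    nlinarith [Nat.zero_le (v ^ 3), Nat.zero_le (v ^ 2)]
  refine Runs.seq ((runs_setupProg hW rfl).mono le_rfl ?_)
  rintro s₁ ⟨g1, g2, g3, g5, gmem⟩
  refine Runs.seq ((runs_linesProg hW hL g1 g2 g3 g5 gmem).mono le_rfl ?_)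
  rintro s₂ ⟨g1, g2, g3, gmem⟩
  refine Runs.seq ((runs_diagonalProg hW g1 g2 g3 gmem).mono le_rfl fun s₃ hs₃ => ?_)
  refine Runs.seq ((hp W s₃ hW' hs₃).mono le_rfl ?_)
  rintro s₄ ⟨h, -⟩
  exact Runs.copy (by omega) (by rw [State.reg_setReg, if_pos rfl, h])

end RAM

/-! ## Systems of equations in Steiner quasigroups -/

namespace SteinerTripleSystem

/-- The quasigroup is totally symmetric, so an equation can be solved for any of its three
variables. -/
theorem op_perm_iff {v : ℕ} (S : SteinerTripleSystem (Fin v)) (x : Fin 3 → Fin v) {a b c : Fin 3}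
    (hab : a ≠ b) (hac : a ≠ c) (hbc : b ≠ c) :
    S.op (x a) (x b) = x c ↔ S.op (x 0) (x 1) = x 2 := by
  have s := fun x y z => @op_swap v S x y z
  have r := fun x y z => @op_swap_right v S x y z
  fin_cases a <;> fin_cases b <;> fin_cases c <;>
    first
    | exact absurd rfl hab
    | exact absurd rfl hac
    | exact absurd rfl hbc
    | exact Iff.rfl
    | exact ⟨s _ _ _, s _ _ _⟩
    | exact ⟨r _ _ _, r _ _ _⟩
    | exact ⟨fun h => s _ _ _ (r _ _ _ h), fun h => r _ _ _ (s _ _ _ h)⟩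
    | exact ⟨fun h => r _ _ _ (s _ _ _ h), fun h => s _ _ _ (r _ _ _ h)⟩
    | exact ⟨fun h => r _ _ _ (s _ _ _ (r _ _ _ h)), fun h => r _ _ _ (s _ _ _ (r _ _ _ h))⟩

/-- The assignment `f` solves the equations `E j 0 * E j 1 = E j 2`. -/
def IsSolution {v : ℕ} (S : SteinerTripleSystem (Fin v)) {J ι : Type*} (E : J → Fin 3 → ι)
    (f : ι → Fin v) : Prop :=
  ∀ j, S.op (f (E j 0)) (f (E j 1)) = f (E j 2)

end SteinerTripleSystem

open SteinerTripleSystem RAM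

/-! ### Counting assignments with one variable free, determined or identified with another. -/

section Assignments

variable {ι X : Type*}

open Classical in
/-- The assignment that takes the value `a` at `x` and agrees with `g` elsewhere. -/
noncomputable def extendAt (x : ι) (a : X) (g : {i // i ≠ x} → X) (i : ι) : X :=
  if h : i = x then a else g ⟨i, h⟩

@[simp] theorem extendAt_self (x : ι) (a : X) (g : {i // i ≠ x} → X) : extendAt x a g x = a := by
  simp [extendAt]

@[simp] theorem extendAt_coe (x : ι) (a : X) (g : {i // i ≠ x} → X) (i : {i // i ≠ x}) :
    extendAt x a g i = g i := by
  simp [extendAt, i.2]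

theorem extendAt_restrict (x : ι) (f : ι → X) : extendAt x (f x) (fun i => f i) = f := by
  ext i
  by_cases h : i = x
  · subst h; simp
  · simp [extendAt, h]

theorem card_assignments_free (x : ι) (Q : ({i // i ≠ x} → X) → Prop) :
    Nat.card {f : ι → X // Q fun i => f i} = Nat.card X * Nat.card {g // Q g} := by
  rw [← Nat.card_prod]
  refine Nat.card_congr ⟨fun f => (f.1 x, ⟨fun i => f.1 i, f.2⟩),
    fun p => ⟨extendAt x p.1 p.2.1, by simpa using p.2.2⟩, fun f => ?_, fun p => ?_⟩
  · exact Subtype.ext (extendAt_restrict x f.1)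
  · simp

theorem card_assignments_determined (x : ι) (h : ({i // i ≠ x} → X) → X)
    (Q : ({i // i ≠ x} → X) → Prop) :
    Nat.card {f : ι → X // (f x = h fun i => f i) ∧ Q fun i => f i} = Nat.card {g // Q g} := by
  refine Nat.card_congr ⟨fun f => ⟨fun i => f.1 i, f.2.2⟩,
    fun g => ⟨extendAt x (h g.1) g.1, by simpa using g.2⟩, fun f => ?_, fun g => ?_⟩
  · refine Subtype.ext ?_
    change extendAt x (h fun i => f.1 i) (fun i => f.1 i) = f.1
    rw [← f.2.1, extendAt_restrict]
  · simp

/-- The map that identifies `z` with another element `x`. -/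
noncomputable def collapse {x z : ι} (h : x ≠ z) : ι → {i // i ≠ z} :=
  extendAt z ⟨x, h⟩ id

theorem comp_collapse {x z : ι} (h : x ≠ z) {f : ι → X} (hf : f x = f z) (i : ι) :
    f (collapse h i) = f i := by
  by_cases hi : i = z
  · subst hi; simp [collapse, hf]
  · simp [collapse, extendAt, hi]

/-- The value at `z` is determined by the other values, being the one at `x`. -/
theorem card_assignments_identify {x z : ι} (h : x ≠ z) (Q : (ι → X) → Prop) :
    Nat.card {f : ι → X // f x = f z ∧ Q f} =
      Nat.card {g : {i // i ≠ z} → X // Q (g ∘ collapse h)} := by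
  rw [← card_assignments_determined z (fun g => g ⟨x, h⟩) fun g => Q (g ∘ collapse h)]
  refine Nat.card_congr (Equiv.subtypeEquivRight fun f => ?_)
  rw [eq_comm]
  refine and_congr_right fun hf => ?_
  have : (fun i : {i // i ≠ z} => f i) ∘ collapse h = f := funext (comp_collapse h hf.symm)
  rw [this]

end Assignments

/-! ### Eliminating variables and equations. -/

section Reductions

variable {J ι : Type*} {E : J → Fin 3 → ι}

/-- The number of solutions of a system of equations, as a function of the Steiner triple
system. -/
noncomputable def solutionCount (E : J → Fin 3 → ι) (v : ℕ) (S : SteinerTripleSystem (Fin v)) : ℕ :=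
  Nat.card {f : ι → Fin v // S.IsSolution E f}

theorem solutionCount_of_unused {x : ι} (hx : ∀ j a, E j a ≠ x) :
    solutionCount E =
      fun v S => v * solutionCount (fun j a => (⟨E j a, hx j a⟩ : {i // i ≠ x})) v S := by
  funext v S
  have := card_assignments_free (X := Fin v) x
    fun g => S.IsSolution (fun j a => (⟨E j a, hx j a⟩ : {i // i ≠ x})) g
  rw [Nat.card_fin] at this
  exact this

theorem isSolution_iff_and {v : ℕ} {S : SteinerTripleSystem (Fin v)} (j : J) {f : ι → Fin v} :
    S.IsSolution E f ↔ S.op (f (E j 0)) (f (E j 1)) = f (E j 2) ∧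
      S.IsSolution (fun k : {k // k ≠ j} => E k) f := by
  refine ⟨fun h => ⟨h j, fun k => h k⟩, fun h k => ?_⟩
  by_cases hk : k = j
  · subst hk; exact h.1
  · exact h.2 ⟨k, hk⟩

theorem exists_third (a b : Fin 3) : ∃ c, a ≠ c ∧ b ≠ c := by
  revert a b; decide

theorem exists_others (a : Fin 3) : ∃ b c : Fin 3, b ≠ c ∧ b ≠ a ∧ c ≠ a := by
  revert a; decide

/-- The equation can be solved for this variable, which no other equation constrains; both can be
dropped without changing the count. -/
theorem solutionCount_of_used_once {j : J} {a : Fin 3}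
    (h : ∀ k b, E k b = E j a → k = j ∧ b = a) :
    solutionCount E = solutionCount fun (k : {k // k ≠ j}) b =>
      (⟨E k b, fun hb => k.2 (h k b hb).1⟩ : {i // i ≠ E j a}) := by
  obtain ⟨b, c, hbc, hb, hc⟩ := exists_others a
  have hb' : E j b ≠ E j a := fun h' => hb (h j b h').2
  have hc' : E j c ≠ E j a := fun h' => hc (h j c h').2
  funext v S
  unfold solutionCount
  rw [← card_assignments_determined (E j a) (fun g => S.op (g ⟨_, hb'⟩) (g ⟨_, hc'⟩))]
  refine Nat.card_congr (Equiv.subtypeEquivRight fun f => ?_)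
  rw [isSolution_iff_and j, ← S.op_perm_iff (fun a => f (E j a)) hbc hb hc, eq_comm]
  rfl

/-- Given the others, equation `j` says only that `x` and `z` have equal values. It is void if they
are the same variable; otherwise `z` is merged into `x`. -/
theorem cubicTime_solutionCount_of_redundant {j : J} {x z : ι}
    (h : ∀ v (S : SteinerTripleSystem (Fin v)) (f : ι → Fin v), S.IsSolution E f ↔
      f x = f z ∧ S.IsSolution (fun k : {k // k ≠ j} => E k) f)
    (h1 : CubicTime (solutionCount fun k : {k // k ≠ j} => E k))
    (h2 : ∀ E' : {k // k ≠ j} → Fin 3 → {i // i ≠ z}, CubicTime (solutionCount E')) :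
    CubicTime (solutionCount E) := by
  by_cases hxz : x = z
  · convert h1 using 1
    funext v S
    refine Nat.card_congr (Equiv.subtypeEquivRight fun f => ?_)
    rw [h, hxz]
    exact and_iff_right rfl
  · convert h2 fun k a => collapse hxz (E k a) using 1
    funext v S
    unfold solutionCount
    simp_rw [h]
    exact card_assignments_identify hxz _

end Reductions

/-! ### Systems whose variables are generated by three of them. -/

section Generation

variable {J ι : Type*} {E : J → Fin 3 → ι}

/-- The variables whose values are determined by the values of three variables by means of the
equations. -/
inductive Generated (E : J → Fin 3 → ι) (G : Fin 3 → ι) : ι → Prop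
  | base (k : Fin 3) : Generated E G (G k)
  | step (j : J) {a b c : Fin 3} (hab : a ≠ b) (hac : a ≠ c) (hbc : b ≠ c)
      (ha : Generated E G (E j a)) (hb : Generated E G (E j b)) : Generated E G (E j c)

theorem Generated.all {G : Fin 3 → ι} {j : J} {a b : Fin 3} (hab : a ≠ b)
    (ha : Generated E G (E j a)) (hb : Generated E G (E j b)) (c : Fin 3) :
    Generated E G (E j c) := by
  by_cases hac : a = c
  · exact hac ▸ ha
  by_cases hbc : b = c
  · exact hbc ▸ hb
  exact .step j hab hac hbc ha hb

theorem Generated.exists_term {G : Fin 3 → ι} {i : ι} (h : Generated E G i) :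
    ∃ t : Term, ∀ v (S : SteinerTripleSystem (Fin v)) f, S.IsSolution E f →
      f i = t.eval S (f ∘ G) := by
  induction h with
  | base k => exact ⟨.var k, fun _ _ _ _ => rfl⟩
  | @step j a b c hab hac hbc _ _ iha ihb =>
    obtain ⟨t, ht⟩ := iha
    obtain ⟨u, hu⟩ := ihb
    refine ⟨.op t u, fun v S f hf => ?_⟩
    rw [Term.eval, ← ht v S f hf, ← hu v S f hf]
    exact ((S.op_perm_iff (fun a => f (E j a)) hab hac hbc).2 (hf j)).symm

/-- A solution is determined by its values on `G`. Conversely, values on `G` extend to a solution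
exactly when the terms satisfy all equations and the term chosen for `G k` returns the `k`-th value.
The second condition is needed since that term need not be the variable `k`. -/
theorem cubicTime_solutionCount_of_generated [Finite J] {G : Fin 3 → ι}
    (hG : ∀ i, Generated E G i) : CubicTime (solutionCount E) := by
  have := Fintype.ofFinite J
  choose t ht using fun i => (hG i).exists_term
  convert CubicTime.card_equations
    ((Finset.univ.toList.map fun j : J => (Term.op (t (E j 0)) (t (E j 1)), t (E j 2))) ++
      (List.finRange 3).map fun k => (t (G k), Term.var k)) using 1
  funext v S
  have key : ∀ g : Fin 3 → Fin v, (∀ e ∈ (Finset.univ.toList.map fun j : J =>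
      (Term.op (t (E j 0)) (t (E j 1)), t (E j 2))) ++
      (List.finRange 3).map fun k => (t (G k), Term.var k), e.1.eval S g = e.2.eval S g) ↔
      S.IsSolution E (fun i => (t i).eval S g) ∧ (fun k => (t (G k)).eval S g) = g := by
    intro g
    simp only [List.mem_append, List.mem_map, Finset.mem_toList, Finset.mem_univ, true_and,
      List.mem_finRange, or_imp, forall_and, forall_exists_index, forall_apply_eq_imp_iff,
      funext_iff]
    rfl
  have key' : ∀ f, S.IsSolution E f → (fun i => (t i).eval S (f ∘ G)) = f :=
    fun f hf => funext fun i => (ht i v S f hf).symm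
  refine Nat.card_congr ⟨fun f => ⟨f.1 ∘ G, (key _).2 ?_⟩,
    fun g => ⟨fun i => (t i).eval S g.1, ((key _).1 g.2).1⟩, fun f => ?_, fun g => ?_⟩
  · have := key' f.1 f.2
    refine ⟨by rw [this]; exact f.2, ?_⟩
    exact congrArg (· ∘ G) this
  · exact Subtype.ext (key' f.1 f.2)
  · exact Subtype.ext ((key _).1 g.2).2

theorem exists_eq_of_card_le_five [Finite J] (hJ : Nat.card J ≤ 5) (x : Fin 6 → J) :
    ∃ k l, k < l ∧ x k = x l := by
  have := Fintype.ofFinite J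
  obtain ⟨k, l, hkl, h⟩ := Fintype.exists_ne_map_eq_of_card_lt x
    (by rw [← Nat.card_eq_fintype_card, Fintype.card_fin]; omega)
  rcases lt_or_gt_of_ne hkl with h' | h'
  · exact ⟨k, l, h', h⟩
  · exact ⟨l, k, h', h.symm⟩

/-- Among at most five lines, no two of which meet in more than one point and whose points all have
degree at least two, there is a triangle, and it generates all points. -/
theorem exists_generators [Finite J] (hJ : Nat.card J ≤ 5) (j₀ : J)
    (hlin : ∀ j k a b a' b', j ≠ k → a ≠ b → E j a = E k a' → E j b = E k b' → False)
    (hdeg : ∀ j a, ∃ k a', k ≠ j ∧ E k a' = E j a) (hcov : ∀ i, ∃ j a, E j a = i) :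
    ∃ G : Fin 3 → ι, ∀ i, Generated E G i := by
  -- `n j a` is another line through the point `a` of line `j`, and `m j a` is the position of that
  -- point on it.
  choose n m hn hm using hdeg
  have hninj : ∀ j, Function.Injective (n j) := by
    intro j a b hab
    by_contra hne
    have hb := hm j b
    rw [← hab] at hb
    exact hlin j (n j a) a b (m j a) (m j b) (hn j a).symm hne (hm j a).symm hb.symm
  -- a triangle
  obtain ⟨q, b, s, hb, hq, hs⟩ : ∃ q b s, b ≠ 0 ∧ q ≠ m j₀ 0 ∧
      E (n j₀ b) s = E (n j₀ 0) q := by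
    obtain ⟨q, r, hqr, hq, hr⟩ := exists_others (m j₀ 0)
    have hne : ∀ q, q ≠ m j₀ 0 → n (n j₀ 0) q ≠ j₀ := by
      intro q hq h
      have h' := hm (n j₀ 0) q
      rw [h] at h'
      exact hlin (n j₀ 0) j₀ q (m j₀ 0) _ 0 (hn j₀ 0) hq h'.symm (hm j₀ 0)
    -- Pigeonhole: `j₀` and its three neighbours are four different lines. The neighbours of `n j₀
    -- 0` at its two points off `j₀` differ from each other, from `j₀` and from `n j₀ 0`. With at
    -- most five lines, one of them is `n j₀ 1` or `n j₀ 2`, which closes a triangle.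
    have hcase : ∃ p, p ≠ m j₀ 0 ∧ (n (n j₀ 0) p = n j₀ 1 ∨ n (n j₀ 0) p = n j₀ 2) := by
      obtain ⟨k, l, hkl, h⟩ := exists_eq_of_card_le_five hJ
        ![j₀, n j₀ 0, n j₀ 1, n j₀ 2, n (n j₀ 0) q, n (n j₀ 0) r]
      have d0 := hn j₀ 0
      have d1 := hn j₀ 1
      have d2 := hn j₀ 2
      have d01 : n j₀ 0 ≠ n j₀ 1 := (hninj j₀).ne (by decide)
      have d02 : n j₀ 0 ≠ n j₀ 2 := (hninj j₀).ne (by decide)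
      have d12 : n j₀ 1 ≠ n j₀ 2 := (hninj j₀).ne (by decide)
      have dq := hne q hq
      have dr := hne r hr
      have dq' := hn (n j₀ 0) q
      have dr' := hn (n j₀ 0) r
      have dqr : n (n j₀ 0) q ≠ n (n j₀ 0) r := (hninj _).ne hqr
      fin_cases k <;> fin_cases l <;> first | exact absurd hkl (by decide) | skip
      all_goals simp at h
      all_goals grind
    obtain ⟨p, hp, h | h⟩ := hcase
    · exact ⟨p, 1, m (n j₀ 0) p, by decide, hp, by rw [← h]; exact hm _ _⟩
    · exact ⟨p, 2, m (n j₀ 0) p, by decide, hp, by rw [← h]; exact hm _ _⟩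
  set G : Fin 3 → ι := ![E j₀ 0, E j₀ b, E (n j₀ 0) q] with hG
  have g0 : Generated E G (E j₀ 0) := .base 0
  have g1 : Generated E G (E j₀ b) := .base 1
  have g2 : Generated E G (E (n j₀ 0) q) := .base 2
  have t0 : ∀ c, Generated E G (E j₀ c) := g0.all hb.symm g1
  have t1 : ∀ c, Generated E G (E (n j₀ 0) c) :=
    Generated.all hq.symm (by rw [hm]; exact g0) g2
  have t2 : ∀ c, Generated E G (E (n j₀ b) c) := by
    refine Generated.all (a := m j₀ b) (b := s) ?_ (by rw [hm]; exact g1) (by rw [hs]; exact g2)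
    -- If the two vertices on the third side coincided, `n j₀ 0` would meet `j₀` in two points.
    rintro rfl
    rw [hm] at hs
    exact hlin j₀ (n j₀ 0) 0 b (m j₀ 0) q (hn j₀ 0).symm hb.symm (hm j₀ 0).symm hs
  have hline : ∀ j c, Generated E G (E j c) := by
    intro j
    by_cases e0 : j = j₀
    · subst e0; exact t0
    by_cases e1 : j = n j₀ 0
    · subst e1; exact t1
    by_cases e2 : j = n j₀ b
    · subst e2; exact t2
    have hgen : ∀ c, n j c = j₀ ∨ n j c = n j₀ 0 ∨ n j c = n j₀ b → Generated E G (E j c) := by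
      rintro c (h | h | h) <;> rw [← hm j c, h]
      exacts [t0 _, t1 _, t2 _]
    -- If two points of a fourth line were not generated, the further lines through them would lie
    -- outside the triangle, giving six different lines. So two points of the line are generated,
    -- and with them the third.
    have hpair : ∀ c d, c ≠ d → Generated E G (E j c) ∨ Generated E G (E j d) := by
      intro c d hcd
      by_contra! hcon
      have hc := fun h => hcon.1 (hgen c h)
      have hd := fun h => hcon.2 (hgen d h)
      obtain ⟨k, l, hkl, h⟩ := exists_eq_of_card_le_five hJ
        ![j₀, n j₀ 0, n j₀ b, j, n j c, n j d]
      have d0 := hn j₀ 0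
      have d1 := hn j₀ b
      have d01 : n j₀ 0 ≠ n j₀ b := (hninj j₀).ne hb.symm
      have dc := hn j c
      have dd := hn j d
      have dcd : n j c ≠ n j d := (hninj j).ne hcd
      fin_cases k <;> fin_cases l <;> first | exact absurd hkl (by decide) | skip
      all_goals simp at h
      all_goals grind
    have h01 := hpair 0 1 (by decide)
    have h02 := hpair 0 2 (by decide)
    have h12 := hpair 1 2 (by decide)
    rcases h01 with h | h
    · rcases h12 with h' | h'
      · exact h.all (by decide) h'
      · exact h.all (by decide) h'
    · rcases h02 with h' | h'
      · exact h.all (by decide) h'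
      · exact h.all (by decide) h'
  refine ⟨G, fun i => ?_⟩
  obtain ⟨j, a, rfl⟩ := hcov i
  exact hline j a

end Generation

-- Counting solutions, without and with inequalities.

universe u w

/-- Induction on the number of equations plus variables: every reduction lowers it and never adds an
equation, and an irreducible nonempty system is generated by three variables. -/
theorem cubicTime_solutionCount (n : ℕ) : ∀ (J : Type u) (ι : Type w) [Finite J] [Finite ι]
    (E : J → Fin 3 → ι), Nat.card J ≤ 5 → Nat.card J + Nat.card ι = n →
      CubicTime (solutionCount E) := by
  induction n using Nat.strong_induction_on with
  | _ n ih =>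
    intro J ι _ _ E hJ hn
    have hcardJ : ∀ j : J, Nat.card {k // k ≠ j} < Nat.card J := fun j =>
      Finite.card_subtype_lt (x := j) (by simp)
    have hcardι : ∀ x : ι, Nat.card {i // i ≠ x} < Nat.card ι := fun x =>
      Finite.card_subtype_lt (x := x) (by simp)
    have hred : ∀ (j : J) (x z : ι), (∀ v (S : SteinerTripleSystem (Fin v)) (f : ι → Fin v),
        S.IsSolution E f ↔ f x = f z ∧ S.IsSolution (fun k : {k // k ≠ j} => E k) f) →
        CubicTime (solutionCount E) := by
      intro j x z h
      have hj := hcardJ j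
      have hz := hcardι z
      exact cubicTime_solutionCount_of_redundant h (ih _ (by omega) _ _ _ (by omega) rfl)
        fun E' => ih _ (by omega) _ _ _ (by omega) rfl
    by_cases hcov : ∀ x, ∃ j a, E j a = x
    swap
    · push Not at hcov
      obtain ⟨x, hx⟩ := hcov
      have := hcardι x
      rw [solutionCount_of_unused hx]
      exact (ih _ (by omega) _ _ _ hJ rfl).order_mul
    by_cases hE : ∀ j, Function.Injective (E j)
    swap
    · simp only [Function.Injective] at hE
      push Not at hE
      obtain ⟨j, a, b, hab, hne⟩ := hE
      obtain ⟨c, hac, hbc⟩ := exists_third a b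
      -- By idempotence, x * x = z says x = z.
      refine hred j (E j a) (E j c) fun v S f => ?_
      rw [isSolution_iff_and j, ← S.op_perm_iff (fun a => f (E j a)) hne hac hbc, hab, S.op_self]
    by_cases hlin : ∀ j k a b a' b', j ≠ k → a ≠ b → E j a = E k a' → E j b = E k b' → False
    swap
    · push Not at hlin
      obtain ⟨j, k, a, b, a', b', hjk, hab, ha, hb, -⟩ := hlin
      have hab' : a' ≠ b' := by
        rintro rfl
        exact hab (hE j (ha.trans hb.symm))
      obtain ⟨c, hac, hbc⟩ := exists_third a b
      obtain ⟨c', hac', hbc'⟩ := exists_third a' b'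
      -- Two equations that share two variables have the same product in the third place.
      refine hred j (E k c') (E j c) fun v S f => ?_
      rw [isSolution_iff_and j, ← S.op_perm_iff (fun a => f (E j a)) hab hac hbc, ha, hb]
      refine and_congr_left fun h => ?_
      rw [(S.op_perm_iff (fun a => f (E k a)) hab' hac' hbc').2 (h ⟨k, hjk.symm⟩)]
    by_cases hdeg : ∀ j a, ∃ k a', k ≠ j ∧ E k a' = E j a
    swap
    · push Not at hdeg
      obtain ⟨j, a, h⟩ := hdeg
      have h' : ∀ k b, E k b = E j a → k = j ∧ b = a := by
        intro k b hkb
        by_cases hk : k = j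
        · subst hk; exact ⟨rfl, hE k hkb⟩
        · exact absurd hkb (h k b hk)
      rw [solutionCount_of_used_once h']
      have := hcardJ j
      have := hcardι (E j a)
      exact ih _ (by omega) _ _ _ (by omega) rfl
    rcases isEmpty_or_nonempty J with hJ' | ⟨⟨j₀⟩⟩
    · have : IsEmpty ι := ⟨fun x => let ⟨j, _⟩ := hcov x; hJ'.false j⟩
      convert CubicTime.one using 1
      funext v S
      have : Unique {f : ι → Fin v // S.IsSolution E f} :=
        ⟨⟨⟨fun i => isEmptyElim i, fun j => isEmptyElim j⟩⟩,
          fun f => Subtype.ext (funext fun i => isEmptyElim i)⟩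
      exact Nat.card_unique
    · obtain ⟨G, hG⟩ := exists_generators hJ j₀ hlin hdeg hcov
      exact cubicTime_solutionCount_of_generated hG

open Classical in
theorem card_subtype_and_not {α : Type*} [Finite α] (P Q : α → Prop) :
    Nat.card {a // P a ∧ ¬ Q a} = Nat.card {a // P a} - Nat.card {a // Q a ∧ P a} := by
  have := Fintype.ofFinite α
  simp only [Nat.card_eq_fintype_card, Fintype.card_subtype]
  have h := Finset.card_filter_add_card_filter_not (s := Finset.univ.filter P) Q
  rw [Finset.filter_filter, Finset.filter_filter] at h
  have h' : Finset.univ.filter (fun a => Q a ∧ P a) = Finset.univ.filter fun a => P a ∧ Q a :=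
    Finset.filter_congr fun a _ => and_comm
  rw [h', eq_comm]
  apply Nat.sub_eq_of_eq_add
  rw [add_comm]
  convert h.symm

/-- Inclusion and exclusion, one inequality per step. Merging variables keeps the number of
equations, so the bound five is preserved. -/
theorem cubicTime_card_solutions_ne (n : ℕ) : ∀ (J : Type u) (ι : Type w) [Finite J] [Finite ι]
    (E : J → Fin 3 → ι) (D : List (ι × ι)), Nat.card J ≤ 5 → D.length = n →
      CubicTime fun v S =>
        Nat.card {f : ι → Fin v // S.IsSolution E f ∧ ∀ d ∈ D, f d.1 ≠ f d.2} := by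
  induction n with
  | zero =>
    intro J ι _ _ E D hJ hD
    obtain rfl := List.eq_nil_of_length_eq_zero hD
    simp only [List.not_mem_nil, false_imp_iff, implies_true, and_true]
    exact cubicTime_solutionCount _ J ι E hJ rfl
  | succ n ih =>
    intro J ι _ _ E D hJ hD
    obtain ⟨⟨x, z⟩, D, rfl⟩ := List.exists_cons_of_length_eq_add_one hD
    have hD' : D.length = n := by simpa using hD
    by_cases hxz : x = z
    · subst hxz
      -- The inequality x ≠ x has no solutions, and zero is written as 1 - 1.
      convert CubicTime.one.sub CubicTime.one using 1
      funext v S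
      simp
    · convert (ih J ι E D hJ hD').sub (ih J {i // i ≠ z} (fun j a => collapse hxz (E j a))
        (D.map fun d => (collapse hxz d.1, collapse hxz d.2)) hJ (by simpa using hD')) using 1
      funext v S
      have h1 := card_assignments_identify (X := Fin v) hxz
        fun f => S.IsSolution E f ∧ ∀ d ∈ D, f d.1 ≠ f d.2
      have h2 := card_subtype_and_not
        (fun f : ι → Fin v => S.IsSolution E f ∧ ∀ d ∈ D, f d.1 ≠ f d.2) fun f => f x = f z
      rw [h1] at h2
      convert h2 using 3
      · funext f
        simp only [List.mem_cons, forall_eq_or_imp]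
        exact propext ⟨fun h => ⟨⟨h.1, h.2.2⟩, h.2.1⟩, fun h => ⟨h.1.1, h.2, h.1.2⟩⟩
      · simp only [List.mem_map, forall_exists_index, and_imp, forall_apply_eq_imp_iff₂]
        rfl

/-! ## Occurrences of configurations -/

section Configurations

variable {V W : Type*}

/-- The isomorphisms between two configurations. -/
def ConfigIso (C : Finset (Finset V)) (D : Finset (Finset W)) : Type _ :=
  {e : configPoints C ≃ configPoints D // ∀ B : Finset (configPoints C),
    B.map (Function.Embedding.subtype _) ∈ C ↔
      (B.map e.toEmbedding).map (Function.Embedding.subtype _) ∈ D}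

/-- The lines of a configuration as sets of points of the configuration. -/
def ConfigLine (C : Finset (Finset V)) : Type _ :=
  {B : Finset (configPoints C) // B.map (Function.Embedding.subtype _) ∈ C}

theorem exists_map_subtype {C : Finset (Finset V)} {L : Finset V} (hL : L ∈ C) :
    ∃ B : Finset (configPoints C), B.map (Function.Embedding.subtype _) = L := by
  classical
  exact ⟨L.subtype (· ∈ configPoints C), Finset.subtype_map_of_mem fun x hx => ⟨L, hL, hx⟩⟩

/-- Composition with an isomorphism. -/
def ConfigIso.congrRight {C : Finset (Finset V)} {D : Finset (Finset W)} (e₀ : ConfigIso C D) :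
    ConfigIso C D ≃ ConfigIso C C where
  toFun e := ⟨e.1.trans e₀.1.symm, fun B => by
    have h : (B.map (e.1.trans e₀.1.symm).toEmbedding).map e₀.1.toEmbedding =
        B.map e.1.toEmbedding := by
      rw [Finset.map_map]
      congr 1
      ext x
      simp
    rw [e.2, e₀.2, h]⟩
  invFun e := ⟨e.1.trans e₀.1, fun B => by
    have h : (B.map e.1.toEmbedding).map e₀.1.toEmbedding =
        B.map (e.1.trans e₀.1).toEmbedding := Finset.map_map ..
    rw [e.2, e₀.2, h]⟩
  left_inv e := Subtype.ext (by simp [Equiv.trans_assoc])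
  right_inv e := Subtype.ext (by simp [Equiv.trans_assoc])

/-- The underlying map into `W` determines the target configuration; hence an embedding belongs to
only one occurrence. -/
theorem ConfigIso.mem_iff {C : Finset (Finset V)} {D : Finset (Finset W)} (e : ConfigIso C D)
    {f : configPoints C ↪ W} (hf : ∀ x, f x = e.1 x) (L : Finset W) :
    L ∈ D ↔ ∃ B : ConfigLine C, L = B.1.map f := by
  have hmap : ∀ B : Finset (configPoints C),
      (B.map e.1.toEmbedding).map (Function.Embedding.subtype _) = B.map f := by
    intro B
    rw [Finset.map_map]
    congr 1
    ext x
    exact (hf x).symm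
  constructor
  · intro hL
    obtain ⟨B', rfl⟩ := exists_map_subtype hL
    have hB' : (B'.map e.1.symm.toEmbedding).map e.1.toEmbedding = B' := by
      simp [Finset.map_map]
    refine ⟨⟨B'.map e.1.symm.toEmbedding, (e.2 _).2 (by rwa [hB'])⟩, ?_⟩
    rw [← hmap, hB']
  · rintro ⟨B, rfl⟩
    rw [← hmap]
    exact (e.2 B.1).1 B.2

/-- The embeddings of a configuration into a Steiner triple system correspond to the isomorphisms
between the configuration and its occurrences. -/
theorem card_embeddings {v : ℕ} (S : SteinerTripleSystem (Fin v)) (C : Finset (Finset V))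
    [Finite (configPoints C)] :
    Nat.card {f : configPoints C ↪ Fin v // ∀ B : ConfigLine C, B.1.map f ∈ S.lines} =
      occurrences C S * Nat.card (ConfigIso C C) := by
  classical
  have := Fintype.ofFinite (configPoints C)
  have hcard : Nat.card (Σ D : {D : Finset (Finset (Fin v)) // IsConfiguration S D ∧
      ConfigIsomorphic C D}, ConfigIso C D.1) = occurrences C S * Nat.card (ConfigIso C C) := by
    have e : (Σ D : {D : Finset (Finset (Fin v)) // IsConfiguration S D ∧
        ConfigIsomorphic C D}, ConfigIso C D.1) ≃ {D : Finset (Finset (Fin v)) //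
          IsConfiguration S D ∧ ConfigIsomorphic C D} × ConfigIso C C :=
      (Equiv.sigmaCongrRight fun D =>
        ConfigIso.congrRight ⟨D.2.2.choose, D.2.2.choose_spec⟩).trans (Equiv.sigmaEquivProd _ _)
    rw [Nat.card_congr e, Nat.card_prod]
    rfl
  rw [← hcard]
  refine (Nat.card_congr (Equiv.ofBijective (fun p => ⟨p.2.1.toEmbedding.trans
    (Function.Embedding.subtype _), fun B => p.1.2.1
      ((p.2.mem_iff (fun _ => rfl) _).2 ⟨B, rfl⟩)⟩) ⟨?_, ?_⟩)).symm
  · rintro ⟨⟨D, hD⟩, e⟩ ⟨⟨D', hD'⟩, e'⟩ h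
    have hf := congrArg Subtype.val h
    dsimp only at hf
    obtain rfl : D = D' := by
      ext L
      rw [e.mem_iff (f := e.1.toEmbedding.trans (Function.Embedding.subtype _)) fun _ => rfl,
        e'.mem_iff (f := e'.1.toEmbedding.trans (Function.Embedding.subtype _)) fun _ => rfl, hf]
    congr 1
    refine Subtype.ext (Equiv.ext fun x => Subtype.ext ?_)
    exact DFunLike.congr_fun hf x
  · rintro ⟨f, hf⟩
    -- The occurrence belonging to an embedding is the image of the lines of `C`.
    set D : Finset (Finset (Fin v)) := (Finset.univ.filter fun B : Finset (configPoints C) =>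
      B.map (Function.Embedding.subtype _) ∈ C).map (Finset.mapEmbedding f).toEmbedding with hD
    have hmem : ∀ L, L ∈ D ↔ ∃ B : ConfigLine C, L = B.1.map f := by
      intro L
      simp only [hD, Finset.mem_map, Finset.mem_filter, Finset.mem_univ, true_and]
      exact ⟨fun ⟨B, hB, h⟩ => ⟨⟨B, hB⟩, h.symm⟩, fun ⟨B, h⟩ => ⟨B.1, B.2, h.symm⟩⟩
    have hpt : ∀ x : configPoints C, f x ∈ configPoints D := by
      rintro ⟨x, L, hL, hx⟩
      obtain ⟨B, rfl⟩ := exists_map_subtype hL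
      refine ⟨B.map f, (hmem _).2 ⟨⟨B, hL⟩, rfl⟩, ?_⟩
      rw [Finset.mem_map']
      obtain ⟨y, hy, hyx⟩ := Finset.mem_map.1 hx
      subst hyx
      exact hy
    let e : configPoints C ≃ configPoints D := Equiv.ofBijective (fun x => ⟨f x, hpt x⟩)
      ⟨fun x y h => f.injective (congrArg Subtype.val h), by
        rintro ⟨y, L, hL, hy⟩
        obtain ⟨B, rfl⟩ := (hmem L).1 hL
        obtain ⟨x, -, rfl⟩ := Finset.mem_map.1 hy
        exact ⟨x, rfl⟩⟩
    have he : ∀ B : Finset (configPoints C), B.map (Function.Embedding.subtype _) ∈ C ↔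
        (B.map e.toEmbedding).map (Function.Embedding.subtype _) ∈ D := by
      intro B
      rw [Finset.map_map, hmem]
      refine ⟨fun h => ⟨⟨B, h⟩, rfl⟩, ?_⟩
      rintro ⟨B', h⟩
      obtain rfl : B = B'.1 := Finset.map_injective f h
      exact B'.2
    refine ⟨⟨⟨D, ?_, e, he⟩, e, he⟩, rfl⟩
    intro L hL
    obtain ⟨B, rfl⟩ := (hmem L).1 hL
    exact hf B

theorem card_configLine_le [Finite V] (C : Finset (Finset V)) :
    Finite (ConfigLine C) ∧ Nat.card (ConfigLine C) ≤ C.card := by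
  have hinj : Function.Injective fun B : ConfigLine C => (⟨_, B.2⟩ : {L // L ∈ C}) :=
    fun B B' h => Subtype.ext (Finset.map_injective _ (congrArg Subtype.val h))
  refine ⟨Finite.of_injective _ hinj, ?_⟩
  simpa using Nat.card_le_card_of_injective _ hinj

theorem cubicTime_occurrences [Finite V] {C : Finset (Finset V)} (h3 : ∀ B ∈ C, B.card = 3)
    (h5 : C.card ≤ 5) : CubicTime fun _ S => occurrences C S := by
  classical
  have := Fintype.ofFinite (configPoints C)
  obtain ⟨hfin, hle⟩ := card_configLine_le C
  have hB : ∀ B : ConfigLine C, ∃ e : Fin 3 → configPoints C,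
      e 0 ≠ e 1 ∧ e 0 ≠ e 2 ∧ e 1 ≠ e 2 ∧ B.1 = {e 0, e 1, e 2} := by
    intro B
    obtain ⟨x, y, z, h⟩ := Finset.card_eq_three.1 ((Finset.card_map _).symm.trans (h3 _ B.2))
    exact ⟨![x, y, z], h⟩
  choose E h01 h02 h12 hE using hB
  have hpos : 0 < Nat.card (ConfigIso C C) := by
    have : Nonempty (ConfigIso C C) := ⟨⟨Equiv.refl _, fun B => by simp⟩⟩
    have : Finite (ConfigIso C C) := Subtype.finite
    exact Nat.card_pos
  convert (cubicTime_card_solutions_ne _ (ConfigLine C) (configPoints C) E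
    (Finset.univ : Finset (configPoints C)).offDiag.toList (hle.trans h5) rfl).div_const
      (Nat.card (ConfigIso C C)) using 1
  funext v S
  refine (Nat.div_eq_of_eq_mul_left hpos ?_).symm
  rw [← card_embeddings]
  have hne : ∀ f : configPoints C → Fin v,
      (∀ d ∈ (Finset.univ : Finset (configPoints C)).offDiag.toList, f d.1 ≠ f d.2) ↔
        Function.Injective f := by
    intro f
    simp only [Finset.mem_toList, Finset.mem_offDiag, Finset.mem_univ, true_and, Prod.forall]
    exact ⟨fun h x y hxy => by_contra fun hne => h x y hne hxy, fun h x y hne hxy => hne (h hxy)⟩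
  -- Injectivity rules out the degenerate solutions x * x = x, so each equation expresses a genuine
  -- line.
  have hsol : ∀ f : configPoints C ↪ Fin v,
      S.IsSolution E f ↔ ∀ B : ConfigLine C, B.1.map f ∈ S.lines := by
    intro f
    refine forall_congr' fun B => ?_
    have hmap : B.1.map f = {f (E B 0), f (E B 1), f (E B 2)} := by
      rw [hE B]; simp
    rw [hmap, S.op_eq_iff, SteinerTripleSystem.Rel, or_iff_right fun h => f.injective.ne (h01 B) h.1]
    exact ⟨fun h => h.2.2.2,
      fun h => ⟨f.injective.ne (h01 B), f.injective.ne (h12 B), f.injective.ne (h02 B), h⟩⟩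
  refine Nat.card_congr ⟨fun f => ⟨⟨f.1, (hne _).1 f.2.2⟩, (hsol _).1 f.2.1⟩,
    fun f => ⟨f.1, (hsol _).2 f.2, (hne _).2 f.1.injective⟩, fun f => rfl, fun f => rfl⟩

end Configurations

theorem theorem5 {V : Type*} [Finite V] (S₀ : SteinerTripleSystem V) (C : Finset (Finset V))
    (hC : IsConfiguration S₀ C) (h5 : C.card = 5) (hvar : IsVariableConfig C) :
    ComputableInTime (fun _ S => occurrences C S) (fun v => (v : ℝ) ^ 3) := by
  exact (cubicTime_occurrences (fun B hB => S₀.card_line B (hC hB)) h5.le).computableInTime
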